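/- Let $(R,\mathfrak m)$ be a Cohen–Macaulay (Noetherian) local ring of dimension $d\ge 1$ with infinite residue field, let $s\ge 1$, and let $\underline I=(I_1,\dots,I_s)$ be $\mathfrak m$-primary ideals of $R$. Write $e=(1,\dots,1)\in\mathbb Z^s$, $\underline I^{n}=I_1^{n_1}\cdots I_s^{n_s}$ for $n\in\mathbb Z^s$ (with $I_i^{m}=R$ for $m\le 0$), order $\mathbb Z^s$ componentwise, and say that a property holds for all large $n$ if it holds for all $n\ge n_0$ for some $n_0\in\mathbb Z^s$. Let $\mathcal F=\{\mathcal F(n)\}_{n\in\mathbb Z^s}$ be an $\underline I$-admissible filtration of ideals of $R$: for all $m,n\in\mathbb Z^s$, $\underline I^{n}\subseteq\mathcal F(n)$, $\mathcal F(m)\mathcal F(n)\subseteq\mathcal F(m+n)$, $\mathcal F(m)\subseteq\mathcal F(n)$ if $m\ge n$, and $\mathcal F(n)=\mathcal F(n^+)$ where $n^+_i=\max(n_i,0)$; and the extended Rees ring $\bigoplus_{n\in\mathbb Z^s}\mathcal F(n)t^{n}$ is a finite module over $\bigoplus_{n\in\mathbb Z^s}\underline I^{n}t^{n}$. Let $\mathcal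 A=\{x_{ij}\in I_i: 1\le i\le s,\ 1\le j\le d\}$ be a complete reduction of $\mathcal F$, that is, with $y_j=x_{1j}\cdots x_{sj}$ and $J=(y_1,\dots,y_d)$ one has $J\mathcal F(n)=\mathcal F(n+e)$ for all large $n$. Let $\lambda$ denote length over $R$, let $H_{\mathcal F}(n)=\lambda(R/\mathcal F(n))$ be the Hilbert function of $\mathcal F$, and let $P_{\mathcal F}$ be its Hilbert polynomial, i.e. the unique polynomial in $s$ variables with rational coefficients such that $P_{\mathcal F}(n)=H_{\mathcal F}(n)$ for all large $n$. For $f$ defined on $\mathbb Z^s$ put $\Delta^1 f(n)=f(n+e)-f(n)$ and $\Delta^k=\Delta^{k-1}\Delta^1$. For $n\in\mathbb Z^s$ let $C_\bullet(\underline y,\mathcal F(n))$ be the multigraded Kirby–Mehran complex $$0\to \frac{R}{\mathcal F(n)}\to\Big(\frac{R}{\mathcal F(n+e)}\Big)^{\binom d1}\to\cdots\to\Big(\frac{R}{\mathcal F(n+(d-1)e)}\Big)^{\binom d{d-1}}\to\frac{R}{\mathcal F(n+de)}\to 0,$$ with $R/\mathcal F(n+de)$ in degree $0$ and $R/\mathcal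 F(n)$ in degree $d$, obtained as the quotient of the Koszul complex of $y_1,\dots,y_d$ on $R$ by its subcomplex whose term in degree $i$ is $\mathcal F(n+(d-i)e)^{\binom di}$. Then the Hilbert polynomial $P_{\mathcal F}$ exists and, for every $n\in\mathbb Z^s$, all lengths below are finite and $$\Delta^d\big(P_{\mathcal F}(n)-H_{\mathcal F}(n)\big)=\lambda\!\left(\frac{\mathcal F(n+de)}{J\,\mathcal F(n+(d-1)e)}\right)-\sum_{i=2}^{d}(-1)^i\,\lambda\big(H_i(C_\bullet(\underline y,\mathcal F(n)))\big).$$ -/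

import Mathlib

universe u

/-- A Noetherian local ring `R` is Cohen-Macaulay if its maximal ideal contains an `R`-regular
sequence of length `dim R`, i.e. `depth R = dim R` (the depth never exceeds the dimension). -/
def IsCohenMacaulayLocal (R : Type u) [CommRing R] [IsLocalRing R] [IsNoetherianRing R] : Prop :=
  ∃ rs : List R, (∀ r ∈ rs, r ∈ IsLocalRing.maximalIdeal R) ∧
    RingTheory.Sequence.IsRegular R rs ∧ (rs.length : WithBot ℕ∞) = ringKrullDim R

/-- An ideal of a local ring that is primary to the maximal ideal. -/
def IsMaximalPrimary {R : Type u} [CommRing R] [IsLocalRing R] (I : Ideal R) : Prop :=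
  I.IsPrimary ∧ I.radical = IsLocalRing.maximalIdeal R

section Filtrations

variable {R : Type u} [CommRing R] {s : ℕ}

/-- The length `λ(K / L)` of the quotient of an ideal `K` by an ideal `L ⊆ K`. -/
noncomputable def quotientLength (K L : Ideal R) : ℕ∞ :=
  Module.length R (K ⧸ L.submoduleOf K)

/-- The monomial `I₁^{n₁} ⋯ Iₛ^{nₛ}` in the ideals `I₁, …, Iₛ`, for an integer vector `n`, with the
convention that `I^m = R` for `m ≤ 0`. -/
def idealMonomial (I : Fin s → Ideal R) (n : Fin s → ℤ) : Ideal R :=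
  ∏ i, I i ^ (n i).toNat

theorem idealMonomial_mul_le (I : Fin s → Ideal R) (m n : Fin s → ℤ) :
    idealMonomial I m * idealMonomial I n ≤ idealMonomial I (m + n) := by
  unfold idealMonomial
  rw [← Finset.prod_mul_distrib]
  refine Finset.prod_le_prod' fun i _ => ?_
  rw [← pow_add]
  refine Ideal.pow_le_pow_right ?_
  simp only [Pi.add_apply]
  omega

theorem idealMonomial_antitone (I : Fin s → Ideal R) : Antitone (idealMonomial I) := by
  intro m n h
  refine Finset.prod_le_prod' fun i _ => ?_
  exact Ideal.pow_le_pow_right (Int.toNat_le_toNat (h i))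

/-- A `ℤˢ`-graded `(I₁, …, Iₛ)`-filtration of ideals. -/
structure MultiFiltration (I : Fin s → Ideal R) where
  /-- The ideals of the filtration. -/
  ideal : (Fin s → ℤ) → Ideal R
  monomial_le : ∀ n, idealMonomial I n ≤ ideal n
  mul_le : ∀ m n, ideal m * ideal n ≤ ideal (m + n)
  antitone : Antitone ideal

namespace MultiFiltration

variable {I : Fin s → Ideal R}

/-- The filtration `{I₁^{n₁} ⋯ Iₛ^{nₛ}}`. -/
def adic (I : Fin s → Ideal R) : MultiFiltration I where
  ideal := idealMonomial I
  monomial_le _ := le_rfl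
  mul_le := idealMonomial_mul_le I
  antitone := idealMonomial_antitone I

theorem ideal_zero (F : MultiFiltration I) : F.ideal 0 = ⊤ := by
  refine top_le_iff.mp (le_trans ?_ (F.monomial_le 0))
  simp [idealMonomial, Ideal.one_eq_top]

/-- The extended Rees ring `⨁_{n ∈ ℤˢ} F(n) tⁿ`, as a subalgebra of the Laurent polynomial ring
`R[t₁^{±1}, …, tₛ^{±1}]`, which is the group algebra of `ℤˢ`. -/
def extendedRees (F : MultiFiltration I) : Subalgebra R (AddMonoidAlgebra R (Fin s → ℤ)) where
  carrier := {f | ∀ n, f.coeff n ∈ F.ideal n}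
  add_mem' {f g} hf hg n := by
    simpa using (F.ideal n).add_mem (hf n) (hg n)
  mul_mem' {f g} hf hg n := by
    classical
    rw [AddMonoidAlgebra.coeff_mul]
    simp only [Finsupp.sum]
    refine Ideal.sum_mem _ fun a _ => Ideal.sum_mem _ fun b _ => ?_
    split_ifs with h
    · rw [← h]
      exact F.mul_le a b (Ideal.mul_mem_mul (hf a) (hg b))
    · exact Ideal.zero_mem _
  algebraMap_mem' r n := by
    classical
    rw [AddMonoidAlgebra.coe_algebraMap]
    simp only [Function.comp_apply, AddMonoidAlgebra.coeff_single, Finsupp.single_apply]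
    split_ifs with h
    · rw [← h, F.ideal_zero]; exact Submodule.mem_top
    · exact Ideal.zero_mem _

theorem extendedRees_adic_le (F : MultiFiltration I) : (adic I).extendedRees ≤ F.extendedRees :=
  fun _ hf n => F.monomial_le n (hf n)

/-- The filtration is `(I₁, …, Iₛ)`-admissible: `F(n) = F(n⁺)` for all `n`, and its extended Rees
ring is a finite module over the extended Rees ring of `(I₁, …, Iₛ)`. -/
structure IsAdmissible (F : MultiFiltration I) : Prop where
  ideal_eq_posPart : ∀ n : Fin s → ℤ, F.ideal n = F.ideal (fun i => max (n i) 0)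
  finite : (Subalgebra.inclusion F.extendedRees_adic_le).Finite

/-- The Hilbert function `H_F(n) = λ(R / F(n))`, as an extended natural number. -/
noncomputable def hilbertFunction (F : MultiFiltration I) (n : Fin s → ℤ) : ℕ∞ :=
  Module.length R (R ⧸ F.ideal n)

/-- `P` is a Hilbert polynomial of `F`: `P(n) = H_F(n) < ∞` for all large `n`, that is, for all
`n ≥ n₀` (componentwise) for some `n₀`. -/
def IsHilbertPolynomial (F : MultiFiltration I) (P : MvPolynomial (Fin s) ℚ) : Prop :=
  ∀ᶠ n : Fin s → ℤ in Filter.atTop,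
    F.hilbertFunction n ≠ ⊤ ∧
    MvPolynomial.eval (fun i => (n i : ℚ)) P = ((F.hilbertFunction n).toNat : ℚ)

theorem IsHilbertPolynomial.unique {F : MultiFiltration I} {P Q : MvPolynomial (Fin s) ℚ}
    (hP : F.IsHilbertPolynomial P) (hQ : F.IsHilbertPolynomial Q) : P = Q := by
  obtain ⟨N, hN⟩ := Filter.eventually_atTop.mp (hP.and hQ)
  refine MvPolynomial.funext_set (fun i => (fun z : ℤ => (z : ℚ)) '' Set.Ici (N i))
    (fun i => (Set.Ici_infinite (N i)).image Int.cast_injective.injOn) fun x hx => ?_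
  choose n hn hnx using fun i => hx i trivial
  obtain rfl : (fun i => (n i : ℚ)) = x := funext hnx
  have h := hN n hn
  rw [h.1.2, h.2.2]

open Classical in
/-- The Hilbert polynomial `P_F` of `F`, i.e. the unique polynomial agreeing with the Hilbert
function for all large `n` (and `0` if there is none). -/
noncomputable def hilbertPolynomial (F : MultiFiltration I) : MvPolynomial (Fin s) ℚ :=
  if h : ∃ P, F.IsHilbertPolynomial P then h.choose else 0

/-- A complete reduction `{x_{ij} ∈ I_i : 1 ≤ i ≤ s, 1 ≤ j ≤ d}` of `F`: with
`y_j = x_{1j} ⋯ x_{sj}`, one has `(y₁, …, y_d) F(n) = F(n + e)` for all large `n`,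
where `e = (1, …, 1)`. -/
structure CompleteReduction (F : MultiFiltration I) (d : ℕ) where
  /-- The elements of the complete reduction. -/
  x : Fin s → Fin d → R
  x_mem : ∀ i j, x i j ∈ I i
  reduction : ∀ᶠ n : Fin s → ℤ in Filter.atTop,
    Ideal.span (Set.range fun j => ∏ i, x i j) * F.ideal n = F.ideal (n + 1)

namespace CompleteReduction

variable {F : MultiFiltration I} {d : ℕ}

/-- `y_j = x_{1j} ⋯ x_{sj}`. -/
def y (A : CompleteReduction F d) (j : Fin d) : R := ∏ i, A.x i j

/-- `J = (y₁, …, y_d)`. -/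
def J (A : CompleteReduction F d) : Ideal R := Ideal.span (Set.range A.y)

theorem y_mem (A : CompleteReduction F d) (j : Fin d) : A.y j ∈ F.ideal 1 := by
  refine F.monomial_le 1 ?_
  simp only [idealMonomial, Pi.one_apply, Int.toNat_one, pow_one]
  exact Ideal.prod_mem_prod fun i _ => A.x_mem i j

end CompleteReduction

end MultiFiltration

end Filtrations

section KirbyMehran

variable {R : Type u} [CommRing R]

/-- The `i`-th term of the Koszul complex of `k` elements of `R`: the free module whose basis
elements `e_S` are indexed by the `i`-element subsets `S` of `{1, …, k}`. An element
`∑ c_S e_S` is given by its coordinates `c`. -/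
abbrev KoszulTerm (R : Type u) (k i : ℕ) : Type u := {S : Finset (Fin k) // S.card = i} → R

/-- The sign `(-1)^{#{t ∈ S : t < j}}`. -/
def koszulSign (R : Type u) [CommRing R] {k : ℕ} (S : Finset (Fin k)) (j : Fin k) : R :=
  (-1) ^ (S.filter (· < j)).card

/-- The Koszul differential `e_S ↦ ∑_{j ∈ S} (-1)^{#{t ∈ S : t < j}} y_j e_{S ∖ {j}}`; in
coordinates, `c` is sent to `T ↦ ∑_{j ∉ T} (-1)^{#{t ∈ T : t < j}} y_j c_{T ∪ {j}}`. -/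
def koszulD {k : ℕ} (y : Fin k → R) (i : ℕ) : KoszulTerm R k (i + 1) →ₗ[R] KoszulTerm R k i where
  toFun c T := ∑ j, if h : j ∈ T.1 then 0 else
    koszulSign R T.1 j * y j * c ⟨insert j T.1, by rw [Finset.card_insert_of_notMem h, T.2]⟩
  map_add' c c' := by
    ext T
    simp only [Pi.add_apply, ← Finset.sum_add_distrib]
    refine Finset.sum_congr rfl fun j _ => ?_
    split_ifs <;> ring
  map_smul' a c := by
    ext T
    simp only [Pi.smul_apply, smul_eq_mul, RingHom.id_apply, Finset.mul_sum]
    refine Finset.sum_congr rfl fun j _ => ?_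
    split_ifs <;> ring

theorem koszulSign_insert {k : ℕ} (T : Finset (Fin k)) {j l : Fin k} (hj : j ∉ T) :
    koszulSign R (insert j T) l = (if j < l then -1 else 1) * koszulSign R T l := by
  unfold koszulSign
  rw [Finset.filter_insert]
  split_ifs with h
  · rw [Finset.card_insert_of_notMem (by simp [hj]), pow_succ]; ring
  · simp

theorem koszulD_comp {k : ℕ} (y : Fin k → R) (i : ℕ) :
    koszulD y i ∘ₗ koszulD y (i + 1) = 0 := by
  refine LinearMap.ext fun c => funext fun T => ?_
  simp only [LinearMap.comp_apply, koszulD, LinearMap.coe_mk, AddHom.coe_mk,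
    LinearMap.zero_apply, Pi.zero_apply]
  let E : Finset (Fin k) → R := fun S => if h : S.card = i + 1 + 1 then c ⟨S, h⟩ else 0
  let A : Fin k × Fin k → R := fun p => if p.1 ∈ T.1 ∨ p.2 ∈ insert p.1 T.1 then 0 else
    koszulSign R T.1 p.1 * y p.1 *
      (koszulSign R (insert p.1 T.1) p.2 * y p.2 * E (insert p.2 (insert p.1 T.1)))
  have hA : ∑ p : Fin k × Fin k, A p = 0 := by
    refine Finset.sum_involution (fun p _ => p.swap) ?_ ?_ ?_ ?_
    · rintro ⟨j, l⟩ -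
      by_cases hj : j ∈ T.1
      · simp [A, hj]
      by_cases hl : l ∈ T.1
      · simp [A, hl]
      rcases lt_trichotomy j l with h | h | h
      · simp only [A, Prod.swap_prod_mk, Finset.mem_insert, hj, hl, h.ne, h.ne', or_self,
          if_false, koszulSign_insert T.1 hj, koszulSign_insert T.1 hl, h, h.not_gt, if_true,
          Finset.insert_comm j l T.1]
        ring
      · subst h; simp [A]
      · simp only [A, Prod.swap_prod_mk, Finset.mem_insert, hj, hl, h.ne, h.ne', or_self,
          if_false, koszulSign_insert T.1 hj, koszulSign_insert T.1 hl, h, h.not_gt, if_true,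
          Finset.insert_comm j l T.1]
        ring
    · rintro ⟨j, l⟩ - h heq
      simp only [Prod.swap_prod_mk, Prod.mk.injEq] at heq
      exact h (by simp [A, heq.1])
    · intro p _; exact Finset.mem_univ _
    · intro p _; exact p.swap_swap
  rw [Fintype.sum_prod_type] at hA
  refine Eq.trans ?_ hA
  refine Finset.sum_congr rfl fun j _ => ?_
  by_cases hj : j ∈ T.1
  · simp [A, hj]
  rw [dif_neg hj, Finset.mul_sum]
  refine Finset.sum_congr rfl fun l _ => ?_
  by_cases hl : l ∈ insert j T.1
  · rw [dif_pos hl, mul_zero]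
    exact (if_pos (Or.inr hl)).symm
  have hcard : (insert l (insert j T.1)).card = i + 1 + 1 := by
    rw [Finset.card_insert_of_notMem hl, Finset.card_insert_of_notMem hj, T.2]
  simp only [A, E, hj, hl, or_self, if_false, dif_neg, dif_pos hcard, not_false_eq_true]

variable {s : ℕ} {I : Fin s → Ideal R}

/-- The degree `n` part of the Koszul complex of `y₁ t^e, …, y_k t^e` on the extended Rees ring of
`F`, in homological degree `i`: the direct sum of copies of `F(n + (k - i)e)`, inside the `i`-th
term of the Koszul complex of `y₁, …, y_k` on `R`. -/
def koszulReesPart (F : MultiFiltration I) (n : Fin s → ℤ) (k i : ℕ) :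
    Submodule R (KoszulTerm R k i) :=
  Submodule.pi Set.univ fun _ => F.ideal (n + ((k : ℤ) - (i : ℤ)) • (1 : Fin s → ℤ))

theorem koszulReesPart_le_comap (F : MultiFiltration I) (n : Fin s → ℤ) {k : ℕ} (y : Fin k → R)
    (hy : ∀ j, y j ∈ F.ideal 1) (i : ℕ) :
    koszulReesPart F n k (i + 1) ≤ (koszulReesPart F n k i).comap (koszulD y i) := by
  intro c hc T _
  change (koszulD y i) c T ∈ F.ideal (n + ((k : ℤ) - (i : ℤ)) • (1 : Fin s → ℤ))
  simp only [koszulD, LinearMap.coe_mk, AddHom.coe_mk]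
  refine Ideal.sum_mem (F.ideal (n + ((k : ℤ) - (i : ℤ)) • (1 : Fin s → ℤ))) fun j _ => ?_
  split_ifs with h
  · exact Ideal.zero_mem _
  · rw [mul_assoc]
    refine Ideal.mul_mem_left _ _ ?_
    have h1 := F.mul_le _ _ (Ideal.mul_mem_mul (hy j)
      (hc ⟨insert j T.1, by rw [Finset.card_insert_of_notMem h, T.2]⟩ trivial))
    refine (congrArg F.ideal ?_).le h1
    ext t
    simp only [Pi.add_apply, Pi.one_apply, Pi.smul_apply, smul_eq_mul]
    push_cast
    ring

/-- The `i`-th term `(R / F(n + (k - i)e))^{binom k i}` of the Kirby-Mehran complex. -/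
abbrev KirbyMehranTerm (F : MultiFiltration I) (n : Fin s → ℤ) (k i : ℕ) : Type u :=
  KoszulTerm R k i ⧸ koszulReesPart F n k i

/-- The differential of the Kirby-Mehran complex, induced by that of the Koszul complex. -/
def kirbyMehranD (F : MultiFiltration I) (n : Fin s → ℤ) {k : ℕ} (y : Fin k → R)
    (hy : ∀ j, y j ∈ F.ideal 1) (i : ℕ) :
    KirbyMehranTerm F n k (i + 1) →ₗ[R] KirbyMehranTerm F n k i :=
  Submodule.mapQ _ _ (koszulD y i) (koszulReesPart_le_comap F n y hy i)

theorem kirbyMehranD_comp (F : MultiFiltration I) (n : Fin s → ℤ) {k : ℕ} (y : Fin k → R)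
    (hy : ∀ j, y j ∈ F.ideal 1) (i : ℕ) :
    kirbyMehranD F n y hy i ∘ₗ kirbyMehranD F n y hy (i + 1) = 0 := by
  refine LinearMap.ext fun c' => ?_
  obtain ⟨c, rfl⟩ := Submodule.mkQ_surjective _ c'
  have h := LinearMap.congr_fun (koszulD_comp y i) c
  simp only [LinearMap.comp_apply, LinearMap.zero_apply] at h
  simp [kirbyMehranD, h]

/-- The multigraded Kirby-Mehran complex `C.(y, F(n))`:
`0 → R/F(n) → (R/F(n+e))^{binom k 1} → ⋯ → (R/F(n+(k-1)e))^{binom k (k-1)} → R/F(n+ke) → 0`,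
with `R/F(n+ke)` in degree `0` and `R/F(n)` in degree `k`; it is the quotient of the Koszul complex
of `y₁, …, y_k` on `R` by the degree `n` part of the Koszul complex of `y₁ t^e, …, y_k t^e` on the
extended Rees ring of `F`. -/
noncomputable def kirbyMehran (F : MultiFiltration I) (n : Fin s → ℤ) {k : ℕ} (y : Fin k → R)
    (hy : ∀ j, y j ∈ F.ideal 1) : ChainComplex (ModuleCat.{u} R) ℕ :=
  ChainComplex.of (fun i => ModuleCat.of R (KirbyMehranTerm F n k i))
    (fun i => ModuleCat.ofHom (kirbyMehranD F n y hy i))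
    (fun i => by
      rw [← ModuleCat.ofHom_comp, kirbyMehranD_comp]
      rfl)

end KirbyMehran

/-! Write `J = (y₁, …, y_d)`. The alternating sum of the lengths of the terms of the Kirby–Mehran
complex at `n` is `Δ^d H(n)`, so it also equals the alternating sum of the homology lengths. Since
`R` is Cohen–Macaulay and `J` contains a power of the maximal ideal, the Koszul complex of `y` on
`R` is exact in positive degrees (`koszulExactMod_of_isWeaklyRegular`). Hence the cokernel of the
differential from degree 2 to degree 1 is `J / J F(n+(d-1)e)`, and degrees 0 and 1 together
contribute `λ(R/J) - λ(F(n+de) / J F(n+(d-1)e))`. This gives `fwdDiff_iter_hilbertFunction`: `Δ^d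
H(n) = λ(R/J) - λ(F(n+de) / J F(n+(d-1)e)) + ∑_{i≥2} (-1)^i λ(H_i)`.

It remains to see that `Δ^d P(n) = λ(R/J)`. Far out on the ray `n + te` the middle term vanishes by
the reduction property, and the homology in degrees at least 2 vanishes by Artin–Rees
(`eventually_length_homology_kirbyMehran_eq_zero`), so there `Δ^d P = Δ^d H = λ(R/J)`. On the ray
`Δ^d P` is a polynomial in `t`, hence constant, and `t = 0` gives the claim. No bound on the degree
of `P` is needed.

For the existence of `P`, admissibility gives `F(m+n) = I^n F(m)` for a suitable `m` and all `n ∈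
ℕˢ`. The lengths `λ(F(m+n) / F(m+n+e_i))` then form the Hilbert function of a multigraded module
which is Noetherian over an algebra generated by finitely many monomials `x t_i`. Induction on the
number of these monomials shows that high differences vanish far out
(`hasVanishingDifferences_length_sub`), and Newton's expansion turns this into a polynomial. -/

/-! ### Acyclicity of the Koszul complex. -/

section Koszul

variable {R : Type u} [CommRing R] {k : ℕ}

/-- Extension by zero of a Koszul chain to all finite subsets. -/
def koszulExt {i : ℕ} (c : KoszulTerm R k i) (S : Finset (Fin k)) : R :=
  if h : S.card = i then c ⟨S, h⟩ else 0

theorem koszulExt_coe {i : ℕ} (c : KoszulTerm R k i) (T : {S : Finset (Fin k) // S.card = i}) :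
    koszulExt c T.1 = c T := by
  simp [koszulExt, T.2]

theorem koszulD_apply (y : Fin k → R) (i : ℕ) (c : KoszulTerm R k (i + 1))
    (T : {S : Finset (Fin k) // S.card = i}) :
    koszulD y i c T =
      ∑ j, if j ∈ T.1 then 0 else koszulSign R T.1 j * y j * koszulExt c (insert j T.1) := by
  simp only [koszulD, LinearMap.coe_mk, AddHom.coe_mk]
  refine Finset.sum_congr rfl fun j _ => ?_
  by_cases h : j ∈ T.1
  · simp [h]
  · have : (insert j T.1).card = i + 1 := by rw [Finset.card_insert_of_notMem h, T.2]
    simp [h, koszulExt, this]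

/-- Exterior multiplication by the `j`-th basis vector on the Koszul complex. -/
def koszulWedge (j : Fin k) (i : ℕ) (c : KoszulTerm R k i) : KoszulTerm R k (i + 1) := fun S =>
  if j ∈ S.1 then koszulSign R S.1 j * koszulExt c (S.1.erase j) else 0

theorem koszulExt_wedge (j : Fin k) (i : ℕ) (c : KoszulTerm R k i) (S : Finset (Fin k)) :
    koszulExt (koszulWedge j i c) S =
      if j ∈ S then koszulSign R S j * koszulExt c (S.erase j) else 0 := by
  by_cases hS : S.card = i + 1
  · simp [koszulExt, hS, koszulWedge]
  · by_cases hj : j ∈ S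
    · have : ¬ (S.erase j).card = i := by
        rw [Finset.card_erase_of_mem hj]
        have := Finset.card_pos.mpr ⟨j, hj⟩
        omega
      simp [koszulExt, hS, this]
    · simp [koszulExt, hS, hj]

theorem koszulSign_mul_self (S : Finset (Fin k)) (j : Fin k) :
    koszulSign R S j * koszulSign R S j = 1 := by
  unfold koszulSign
  rw [← mul_pow]; simp

/-- Wedging with `e_j` is a null-homotopy of multiplication by `y_j`. In the coordinate `T`, the
summand `l = j` gives `y_j c_T`; the summands with `l ≠ j` cancel, because exactly one of `j < l`
and `l < j` flips a sign. -/
theorem koszulD_wedge (y : Fin k → R) (j : Fin k) (i : ℕ) (c : KoszulTerm R k (i + 1)) :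
    koszulD y (i + 1) (koszulWedge j (i + 1) c) + koszulWedge j i (koszulD y i c) = y j • c := by
  funext T
  simp only [Pi.add_apply, Pi.smul_apply, smul_eq_mul]
  rw [koszulD_apply]
  simp only [koszulExt_wedge]
  by_cases hj : j ∈ T.1
  · have hU : (T.1.erase j).card = i := by rw [Finset.card_erase_of_mem hj, T.2]; rfl
    have hjU : j ∉ T.1.erase j := Finset.notMem_erase j T.1
    obtain ⟨U, hTU⟩ : ∃ U, U = T.1.erase j := ⟨_, rfl⟩
    have hT : insert j U = T.1 := by rw [hTU, Finset.insert_erase hj]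
    rw [← hTU] at hU hjU
    have e1 : koszulWedge j i (koszulD y i c) T = koszulSign R T.1 j * koszulD y i c ⟨U, hU⟩ := by
      simp [koszulWedge, hj, ← hTU, koszulExt, hU]
    rw [e1, koszulD_apply, Finset.mul_sum, ← Finset.sum_add_distrib,
      Finset.sum_eq_single_of_mem j (Finset.mem_univ j)]
    · rw [if_pos hj, if_neg hjU]
      simp only [hT, koszulExt_coe, zero_add]
      rw [← hT, koszulSign_insert U hjU]
      simp only [lt_irrefl, if_false, one_mul]
      linear_combination (y j * c T) * koszulSign_mul_self (R := R) U j
    · intro l _ hl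
      by_cases hlU : l ∈ U
      · have : l ∈ T.1 := by rw [← hT]; exact Finset.mem_insert_of_mem hlU
        simp [this, hlU]
      · have hlT : l ∉ T.1 := by rw [← hT]; simp [hl, hlU]
        have : (insert l T.1).erase j = insert l U := by
          rw [Finset.erase_insert_of_ne hl, ← hTU]
        rw [if_neg hlT, if_neg hlU, if_pos (Finset.mem_insert_of_mem hj), this,
          koszulSign_insert T.1 hlT, ← hT, koszulSign_insert U hjU, koszulSign_insert U hjU]
        rcases lt_or_gt_of_ne hl with h | h
        · simp only [h, h.not_gt, if_true, if_false, lt_irrefl]; ring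
        · simp only [h, h.not_gt, if_true, if_false, lt_irrefl]; ring
  · have e1 : koszulWedge j i (koszulD y i c) T = 0 := by simp [koszulWedge, hj]
    rw [e1, add_zero, Finset.sum_eq_single_of_mem j (Finset.mem_univ j)]
    · rw [if_neg hj, if_pos (Finset.mem_insert_self j _), Finset.erase_insert hj, koszulExt_coe,
        koszulSign_insert T.1 hj]
      simp only [lt_irrefl, if_false, one_mul]
      linear_combination (y j * c T) * koszulSign_mul_self (R := R) T.1 j
    · intro l _ hl
      have : j ∉ insert l T.1 := by simp [hj, hl.symm]
      simp [this]

theorem koszulExt_mem {𝔞 : Ideal R} {i : ℕ} {c : KoszulTerm R k i} (hc : ∀ T, c T ∈ 𝔞)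
    (S : Finset (Fin k)) : koszulExt c S ∈ 𝔞 := by
  unfold koszulExt
  split_ifs
  · exact hc _
  · exact 𝔞.zero_mem

theorem koszulWedge_mem {𝔞 : Ideal R} {i : ℕ} {c : KoszulTerm R k i} (hc : ∀ T, c T ∈ 𝔞)
    (j : Fin k) (S) : koszulWedge j i c S ∈ 𝔞 := by
  unfold koszulWedge
  split_ifs
  · exact 𝔞.mul_mem_left _ (koszulExt_mem hc _)
  · exact 𝔞.zero_mem

theorem koszulD_mem {𝔞 : Ideal R} (y : Fin k → R) {i : ℕ} {c : KoszulTerm R k (i + 1)}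
    (hc : ∀ T, c T ∈ 𝔞) (T) : koszulD y i c T ∈ 𝔞 := by
  rw [koszulD_apply]
  refine Ideal.sum_mem _ fun j _ => ?_
  split_ifs
  · exact 𝔞.zero_mem
  · exact 𝔞.mul_mem_left _ (koszulExt_mem hc _)

theorem koszulD_koszulD (y : Fin k → R) (i : ℕ) (c : KoszulTerm R k (i + 1 + 1)) :
    koszulD y i (koszulD y (i + 1) c) = 0 :=
  LinearMap.congr_fun (koszulD_comp y i) c

/-- Elements of the ideal generated by `y` annihilate Koszul homology modulo `𝔞`. -/
theorem exists_koszulD_of_mem_span (y : Fin k → R) (𝔞 : Ideal R) (i : ℕ)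
    (z : KoszulTerm R k (i + 1)) (hz : ∀ T, koszulD y i z T ∈ 𝔞) (a : R)
    (ha : a ∈ Ideal.span (Set.range y)) :
    ∃ w, ∀ T, (a • z - koszulD y (i + 1) w) T ∈ 𝔞 := by
  induction ha using Submodule.span_induction with
  | mem x hx =>
    obtain ⟨j, rfl⟩ := hx
    refine ⟨koszulWedge j (i + 1) z, fun T => ?_⟩
    rw [← koszulD_wedge y j i z, add_sub_cancel_left]
    exact koszulWedge_mem hz j T
  | zero => exact ⟨0, fun T => by simp⟩
  | add a b _ _ ha hb =>
    obtain ⟨v, hv⟩ := ha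
    obtain ⟨w, hw⟩ := hb
    refine ⟨v + w, fun T => ?_⟩
    have : (a + b) • z - koszulD y (i + 1) (v + w) =
        (a • z - koszulD y (i + 1) v) + (b • z - koszulD y (i + 1) w) := by
      rw [map_add, add_smul]; abel
    rw [this]
    exact 𝔞.add_mem (hv T) (hw T)
  | smul r a _ ha =>
    obtain ⟨v, hv⟩ := ha
    refine ⟨r • v, fun T => ?_⟩
    rw [map_smul, smul_assoc, ← smul_sub]
    exact 𝔞.mul_mem_left r (hv T)

/-- Exactness of the Koszul complex of `y` on `R ⧸ 𝔞` in degree `i + 1`. -/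
def KoszulExactMod (y : Fin k → R) (𝔞 : Ideal R) (i : ℕ) : Prop :=
  ∀ z : KoszulTerm R k (i + 1), (∀ T, koszulD y i z T ∈ 𝔞) →
    ∃ u, ∀ T, (z - koszulD y (i + 1) u) T ∈ 𝔞

/-- This is the long exact sequence of `0 → R/𝔞 → R/𝔞 → R/(𝔞+(a)) → 0` done by hand: the vanishing
of homology one degree higher over `R/(𝔞+(a))` makes `a` injective on the homology over `R/𝔞`, while
`a ^ N`, lying in the ideal of `y`, acts on it as zero. -/
theorem KoszulExactMod.of_sup_span {y : Fin k → R} {𝔞 : Ideal R} {i : ℕ} {a : R}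
    (ha : ∀ x, a * x ∈ 𝔞 → x ∈ 𝔞) {N : ℕ} (hN : a ^ N ∈ Ideal.span (Set.range y))
    (h : KoszulExactMod y (𝔞 ⊔ Ideal.span {a}) (i + 1)) : KoszulExactMod y 𝔞 i := by
  -- Injectivity of `a` on homology: if `a z ≡ D w` modulo `𝔞`, then `w` is a cycle modulo `𝔞 +
  -- (a)`, so `w = α + a u + D v` with `α` in `𝔞`; thus `a (z - D u)` has coordinates in `𝔞`.
  have step : ∀ (z : KoszulTerm R k (i + 1)) (w : KoszulTerm R k (i + 1 + 1)),
      (∀ T, koszulD y i z T ∈ 𝔞) → (∀ T, (a • z - koszulD y (i + 1) w) T ∈ 𝔞) →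
      ∃ u, ∀ T, (z - koszulD y (i + 1) u) T ∈ 𝔞 := by
    intro z w hz hw
    obtain ⟨v, hv⟩ := h w fun T => by
      have h1 : koszulD y (i + 1) w T = a * z T - (a • z - koszulD y (i + 1) w) T := by simp
      rw [h1]
      refine Ideal.sub_mem _ ?_ (Ideal.mem_sup_left (hw T))
      exact Ideal.mem_sup_right (Ideal.mul_mem_right _ _ (Ideal.mem_span_singleton_self a))
    have hv' : ∀ T, ∃ α ∈ 𝔞, ∃ u : R, α + a * u = (w - koszulD y (i + 1 + 1) v) T := by
      intro T
      obtain ⟨α, hα, b, hb, hab⟩ := Submodule.mem_sup.mp (hv T)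
      obtain ⟨u, rfl⟩ := Ideal.mem_span_singleton'.mp hb
      exact ⟨α, hα, u, by rw [mul_comm, hab]⟩
    choose α hα u hu using hv'
    have hw2 : w = α + a • u + koszulD y (i + 1 + 1) v := by
      funext T
      have := hu T
      simp only [Pi.sub_apply] at this
      simp only [Pi.add_apply, Pi.smul_apply, smul_eq_mul]
      rw [this]; ring
    refine ⟨u, fun T => ha _ ?_⟩
    have h2 : koszulD y (i + 1) w = koszulD y (i + 1) α + a • koszulD y (i + 1) u := by
      conv_lhs => rw [hw2]
      rw [map_add, map_add, koszulD_koszulD, map_smul, add_zero]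
    have h3 : a * (z - koszulD y (i + 1) u) T =
        (a • z - koszulD y (i + 1) w) T + koszulD y (i + 1) α T := by
      rw [h2]
      simp only [Pi.sub_apply, Pi.add_apply, Pi.smul_apply, smul_eq_mul]
      ring
    rw [h3]
    exact 𝔞.add_mem (hw T) (koszulD_mem y hα T)
  have power : ∀ (M : ℕ) (z : KoszulTerm R k (i + 1)), (∀ T, koszulD y i z T ∈ 𝔞) →
      (∃ w, ∀ T, (a ^ M • z - koszulD y (i + 1) w) T ∈ 𝔞) →
      ∃ u, ∀ T, (z - koszulD y (i + 1) u) T ∈ 𝔞 := by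
    intro M
    induction M with
    | zero => intro z _ hw; simpa using hw
    | succ M ih =>
      rintro z hz ⟨w, hw⟩
      refine ih z hz (step (a ^ M • z) w (fun T => ?_) ?_)
      · rw [map_smul]; exact 𝔞.mul_mem_left _ (hz T)
      · rwa [smul_smul, ← pow_succ']
  exact fun z hz => power N z hz (exists_koszulD_of_mem_span y 𝔞 i z hz _ hN)

theorem koszulExactMod_of_card_le (y : Fin k → R) (𝔞 : Ideal R) {i : ℕ} (hi : k ≤ i) :
    KoszulExactMod y 𝔞 i := by
  refine fun z _ => ⟨0, fun T => ?_⟩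
  have h1 := T.1.card_le_univ
  rw [T.2, Fintype.card_fin] at h1
  omega

/-- The Koszul complex of `k` elements is exact in positive degrees as soon as the radical of the
ideal they generate contains a weakly regular sequence of length `k`. -/
theorem koszulExactMod_of_isWeaklyRegular (y : Fin k → R) (rs : List R) (hk : k ≤ rs.length)
    (hrs : RingTheory.Sequence.IsWeaklyRegular R rs)
    (hy : ∀ r ∈ rs, r ∈ (Ideal.span (Set.range y)).radical) (i : ℕ) :
    KoszulExactMod y ⊥ i := by
  -- Descending induction on the number `j` of regular elements killed. With all of them killed,
  -- only degrees above `k` are claimed, where there are no chains; restoring one element gains one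
  -- degree, and `k ≤ rs.length` suffices to reach every positive degree.
  have key : ∀ m j : ℕ, j + m = rs.length →
      ∀ i, k ≤ i + m → KoszulExactMod y (Ideal.ofList (rs.take j)) i := by
    intro m
    induction m with
    | zero => intro j _ i hi; exact koszulExactMod_of_card_le y _ (by simpa using hi)
    | succ m ih =>
      intro j hj i hi
      have hjl : j < rs.length := by omega
      have h1 := ih (j + 1) (by omega) (i + 1) (by omega)
      rw [List.take_succ_eq_append_getElem hjl, Ideal.ofList_append, Ideal.ofList_singleton] at h1
      obtain ⟨N, hN⟩ := hy rs[j] (List.getElem_mem hjl)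
      refine h1.of_sup_span (fun x hx => ?_) hN
      have h2 := hrs.regular_mod_prev j hjl
      rw [smul_eq_mul, Ideal.mul_top] at h2
      have h3 : (Ideal.Quotient.mk (Ideal.ofList (rs.take j))) x = 0 := by
        refine h2 ?_
        simp only [smul_zero]
        exact Ideal.Quotient.eq_zero_iff_mem.mpr hx
      exact Ideal.Quotient.eq_zero_iff_mem.mp h3
  have := key rs.length 0 (by simp) i (by omega)
  simpa using this

end Koszul

/-! ### Additivity of length. -/

section Length

variable {R : Type u} [CommRing R]

theorem Submodule.length_add_length_quotient {M : Type*} [AddCommGroup M] [Module R M]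
    (N : Submodule R M) : Module.length R N + Module.length R (M ⧸ N) = Module.length R M :=
  (Module.length_eq_add_of_exact N.subtype N.mkQ N.injective_subtype N.mkQ_surjective
    (LinearMap.exact_subtype_mkQ N)).symm

theorem LinearMap.length_ker_add_length_range {M N : Type*} [AddCommGroup M] [Module R M]
    [AddCommGroup N] [Module R N] (f : M →ₗ[R] N) :
    Module.length R (LinearMap.ker f) + Module.length R (LinearMap.range f) =
      Module.length R M := by
  rw [← Submodule.length_add_length_quotient (LinearMap.ker f), f.quotKerEquivRange.length_eq]

theorem length_quotient_add_quotientLength {K L : Ideal R} (h : L ≤ K) :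
    quotientLength K L + Module.length R (R ⧸ K) = Module.length R (R ⧸ L) := by
  have h1 := LinearMap.length_ker_add_length_range (Submodule.factor h)
  have hs : LinearMap.range (Submodule.factor h) = ⊤ :=
    LinearMap.range_eq_top.mpr (Submodule.factor_surjective h)
  rw [hs, Module.length_top] at h1
  rw [← h1]
  congr 1
  have e : LinearMap.ker (Submodule.factor h) = LinearMap.range ((Submodule.mkQ L).comp K.subtype) := by
    rw [Submodule.factor, Submodule.ker_mapQ, Submodule.comap_id, LinearMap.range_comp,
      Submodule.range_subtype]
  rw [e, ← ((Submodule.mkQ L).comp K.subtype).quotKerEquivRange.length_eq]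
  unfold quotientLength
  have e2 : L.submoduleOf K = LinearMap.ker ((Submodule.mkQ L).comp K.subtype) := by
    rw [LinearMap.ker_comp, Submodule.ker_mkQ]; rfl
  rw [e2]

open CategoryTheory in
theorem CategoryTheory.ShortComplex.length_range_add_length_homology
    (S : ShortComplex (ModuleCat.{u} R)) :
    Module.length R (LinearMap.range S.f.hom) + Module.length R S.homology =
      Module.length R (LinearMap.ker S.g.hom) := by
  rw [← Submodule.length_add_length_quotient (LinearMap.range S.moduleCatToCycles)]
  congr 1
  · have h : LinearMap.range S.f.hom =
        (LinearMap.range S.moduleCatToCycles).map (LinearMap.ker S.g.hom).subtype := by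
      rw [← LinearMap.range_comp]
      rfl
    rw [h]
    exact ((Submodule.equivMapOfInjective _ (Submodule.injective_subtype _) _).length_eq).symm
  · exact S.moduleCatHomologyIso.toLinearEquiv.length_eq

end Length

/-! ### Terms, homology and degree one of the Kirby–Mehran complex. -/

section KirbyMehran

variable {R : Type u} [CommRing R] {s : ℕ} {I : Fin s → Ideal R}
  (F : MultiFiltration I) (n : Fin s → ℤ) {k : ℕ} (y : Fin k → R) (hy : ∀ j, y j ∈ F.ideal 1)

open CategoryTheory in
theorem length_range_add_length_homology_kirbyMehran (i : ℕ) :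
    Module.length R (LinearMap.range (kirbyMehranD F n y hy (i + 1))) +
        Module.length R ((kirbyMehran F n y hy).homology (i + 1)) =
      Module.length R (LinearMap.ker (kirbyMehranD F n y hy i)) := by
  let K := kirbyMehran F n y hy
  have h := (K.sc' (i + 1 + 1) (i + 1) i).length_range_add_length_homology
  have e : K.homology (i + 1) ≅ (K.sc' (i + 1 + 1) (i + 1) i).homology :=
    ShortComplex.homologyMapIso (K.isoSc' (i + 1 + 1) (i + 1) i (by simp) (by simp))
  rw [← e.toLinearEquiv.length_eq] at h
  have hf : (K.sc' (i + 1 + 1) (i + 1) i).f = ModuleCat.ofHom (kirbyMehranD F n y hy (i + 1)) :=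
    ChainComplex.of_d (fun i => ModuleCat.of R (KirbyMehranTerm F n k i)) (fun i => ModuleCat.ofHom (kirbyMehranD F n y hy i)) _
  have hg : (K.sc' (i + 1 + 1) (i + 1) i).g = ModuleCat.ofHom (kirbyMehranD F n y hy i) :=
    ChainComplex.of_d (fun i => ModuleCat.of R (KirbyMehranTerm F n k i)) (fun i => ModuleCat.ofHom (kirbyMehranD F n y hy i)) _
  rw [hf, hg] at h
  exact h

theorem length_kirbyMehranTerm (i : ℕ) :
    Module.length R (KirbyMehranTerm F n k i) =
      k.choose i * F.hilbertFunction (n + ((k : ℤ) - (i : ℤ)) • (1 : Fin s → ℤ)) := by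
  unfold KirbyMehranTerm koszulReesPart
  rw [(Submodule.quotientPi _).length_eq, Module.length_pi_of_fintype]
  simp only [Finset.sum_const, Finset.card_univ, nsmul_eq_mul, Fintype.card_finset_len,
    Fintype.card_fin]
  rfl

open CategoryTheory in
theorem length_homology_kirbyMehran_le (i : ℕ) :
    Module.length R ((kirbyMehran F n y hy).homology i) ≤
      Module.length R (KirbyMehranTerm F n k i) := by
  have h := ((kirbyMehran F n y hy).sc i).length_range_add_length_homology
  calc _ ≤ _ := le_add_self
    _ = _ := h
    _ ≤ _ := Module.length_le_of_injective (LinearMap.ker _).subtype (Submodule.injective_subtype _)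

theorem mem_span_range_mul_iff (y : Fin k → R) (𝔞 : Ideal R) (x : R) :
    x ∈ Ideal.span (Set.range y) * 𝔞 ↔ ∃ p : Fin k → R, (∀ j, p j ∈ 𝔞) ∧ x = ∑ j, y j * p j := by
  rw [mul_comm, ← smul_eq_mul, Ideal.span, Submodule.mem_ideal_smul_span_iff_exists_sum]
  constructor
  · rintro ⟨a, ha, rfl⟩
    exact ⟨a, ha, by simp [Finsupp.sum_fintype, mul_comm]⟩
  · rintro ⟨p, hp, rfl⟩
    exact ⟨Finsupp.equivFunOnFinite.symm p, hp, by simp [Finsupp.sum_fintype, mul_comm]⟩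

/-- The Koszul differential in degree `1`, with values in `R`. -/
def koszulAugmentation (y : Fin k → R) : KoszulTerm R k (0 + 1) →ₗ[R] R :=
  (LinearMap.proj (⟨∅, rfl⟩ : {S : Finset (Fin k) // S.card = 0})).comp (koszulD y 0)

theorem koszulAugmentation_apply (y : Fin k → R) (c : KoszulTerm R k (0 + 1)) :
    koszulAugmentation y c = ∑ j, y j * c ⟨{j}, by simp⟩ := by
  unfold koszulAugmentation
  rw [LinearMap.comp_apply, LinearMap.proj_apply, koszulD_apply]
  refine Finset.sum_congr rfl fun j _ => ?_
  simp [koszulSign, koszulExt]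

theorem koszulD_zero_eq_zero_iff (y : Fin k → R) (c : KoszulTerm R k (0 + 1)) :
    koszulD y 0 c = 0 ↔ koszulAugmentation y c = 0 := by
  constructor
  · intro h; simp [koszulAugmentation, h]
  · intro h
    funext T
    obtain ⟨T, hT⟩ := T
    obtain rfl := Finset.card_eq_zero.mp hT
    exact h

-- Chains of degree 1 are `k`-tuples, the index sets being singletons. The second clause lets
-- membership in an ideal pass from the tuple to the chain.
omit [CommRing R] in
theorem exists_koszulTerm_one (p : Fin k → R) :
    ∃ c : KoszulTerm R k (0 + 1), (∀ j, c ⟨{j}, by simp⟩ = p j) ∧ ∀ T, ∃ j, c T = p j := by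
  refine ⟨fun T => p (Finset.card_eq_one.mp T.2).choose, fun j => ?_, fun T => ⟨_, rfl⟩⟩
  have h : ({j} : Finset (Fin k)).card = 1 := by simp
  exact congrArg p (Finset.singleton_injective (Finset.card_eq_one.mp h).choose_spec).symm

/-- If the Koszul complex of `y` is exact in degree one, then the cokernel of the second
differential of the Kirby-Mehran complex has the length of `J / J F(n + (k - 1) e)`. -/
theorem length_kirbyMehranTerm_one (hex : KoszulExactMod y ⊥ 0) :
    Module.length R (KirbyMehranTerm F n k 1) +
        Module.length R (R ⧸ Ideal.span (Set.range y)) =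
      Module.length R (LinearMap.range (kirbyMehranD F n y hy 1)) +
        Module.length R (R ⧸ Ideal.span (Set.range y) *
          F.ideal (n + ((k : ℤ) - 1) • (1 : Fin s → ℤ))) := by
  set F' := F.ideal (n + ((k : ℤ) - 1) • (1 : Fin s → ℤ))
  set J := Ideal.span (Set.range y)
  have hP : ∀ c : KoszulTerm R k (0 + 1),
      c ∈ koszulReesPart F n k (0 + 1) ↔ ∀ T, c T ∈ F' := by
    intro c
    simp [koszulReesPart, Submodule.mem_pi, F']
  let ψ' : KoszulTerm R k (0 + 1) →ₗ[R] R ⧸ J * F' :=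
    (Submodule.mkQ (J * F')).comp (koszulAugmentation y)
  have hψ' : koszulReesPart F n k (0 + 1) ≤ LinearMap.ker ψ' := by
    intro c hc
    rw [hP] at hc
    rw [LinearMap.mem_ker, LinearMap.comp_apply, Submodule.mkQ_apply, Submodule.Quotient.mk_eq_zero,
      mem_span_range_mul_iff]
    exact ⟨_, fun j => hc _, koszulAugmentation_apply y c⟩
  let ψ : KirbyMehranTerm F n k (0 + 1) →ₗ[R] R ⧸ J * F' := Submodule.liftQ _ ψ' hψ'
  -- If `∑ y_j c_j = ∑ y_j p_j` with all `p_j` in `F'`, then `c - p` is a Koszul cycle on `R`, hence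
  -- a boundary; so `c` is a boundary modulo `F'`.
  have hker : LinearMap.ker ψ = LinearMap.range (kirbyMehranD F n y hy 1) := by
    ext c
    obtain ⟨c, rfl⟩ := Submodule.mkQ_surjective _ c
    rw [LinearMap.mem_ker, LinearMap.mem_range]
    have e1 : ψ (Submodule.mkQ _ c) = Submodule.mkQ (J * F') (koszulAugmentation y c) := rfl
    rw [e1, Submodule.mkQ_apply, Submodule.Quotient.mk_eq_zero, mem_span_range_mul_iff]
    constructor
    · rintro ⟨p, hp, h⟩
      obtain ⟨b, hb1, hb2⟩ := exists_koszulTerm_one p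
      have hb : b ∈ koszulReesPart F n k (0 + 1) := by
        rw [hP]
        intro T
        obtain ⟨j, hj⟩ := hb2 T
        rw [hj]; exact hp j
      have h0 : koszulD y 0 (c - b) = 0 := by
        rw [koszulD_zero_eq_zero_iff, map_sub, h, koszulAugmentation_apply]
        simp [hb1]
      obtain ⟨u, hu⟩ := hex (c - b) (fun T => by rw [h0]; simp)
      refine ⟨Submodule.mkQ _ u, ?_⟩
      change Submodule.mkQ _ (koszulD y 1 u) = _
      have : koszulD y 1 u = c - b := by
        funext T
        have := hu T
        rw [Ideal.mem_bot, Pi.sub_apply, sub_eq_zero] at this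
        exact this.symm
      rw [this, map_sub, sub_eq_self]
      exact (Submodule.Quotient.mk_eq_zero _).mpr hb
    · rintro ⟨u, hu⟩
      obtain ⟨u, rfl⟩ := Submodule.mkQ_surjective _ u
      change Submodule.mkQ _ (koszulD y 1 u) = _ at hu
      rw [← sub_eq_zero, ← map_sub, Submodule.mkQ_apply, Submodule.Quotient.mk_eq_zero, hP] at hu
      refine ⟨fun j => -(koszulD y 1 u - c) ⟨{j}, by simp⟩, fun j => F'.neg_mem (hu _), ?_⟩
      have h1 : koszulAugmentation y (koszulD y 1 u) = 0 :=
        (koszulD_zero_eq_zero_iff y _).mp (koszulD_koszulD y 0 u)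
      have h2 : koszulAugmentation y c = koszulAugmentation y (-(koszulD y 1 u - c)) := by
        rw [map_neg, map_sub, h1]; simp
      rw [h2, koszulAugmentation_apply]
      rfl
  have hrange : LinearMap.range ψ = Submodule.map (Submodule.mkQ (J * F')) J := by
    rw [Submodule.range_liftQ, LinearMap.range_comp]
    congr 1
    ext x
    have := mem_span_range_mul_iff y ⊤ x
    rw [Ideal.mul_top] at this
    change _ ↔ x ∈ Ideal.span (Set.range y)
    rw [this]
    constructor
    · rintro ⟨c, rfl⟩
      exact ⟨_, fun j => trivial, koszulAugmentation_apply y c⟩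
    · rintro ⟨p, -, h⟩
      obtain ⟨b, hb1, -⟩ := exists_koszulTerm_one p
      exact ⟨b, by rw [h, koszulAugmentation_apply]; simp [hb1]⟩
  have h1 := LinearMap.length_ker_add_length_range ψ
  rw [hker] at h1
  have h2 := Submodule.length_add_length_quotient (LinearMap.range ψ)
  have hle : J * F' ≤ J := Ideal.mul_le_left
  have h3 : Module.length R ((R ⧸ J * F') ⧸ LinearMap.range ψ) = Module.length R (R ⧸ J) := by
    rw [hrange]
    exact (Submodule.quotientQuotientEquivQuotient (J * F') J hle).length_eq
  rw [h3] at h2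
  rw [← h2, ← add_assoc]
  exact congrArg (· + Module.length R (R ⧸ J)) h1.symm

end KirbyMehran

/-! ### The Euler characteristic of the Kirby–Mehran complex. -/

section EulerCharacteristic

theorem ENat.toNat_eq_sub_sub {a h b c : ℕ∞} (ha : a ≠ ⊤) (hh : h ≠ ⊤) (hb : b ≠ ⊤)
    (H : a + h + b = c) : (h.toNat : ℚ) = (c.toNat : ℚ) - (b.toNat : ℚ) - (a.toNat : ℚ) := by
  lift a to ℕ using ha
  lift h to ℕ using hh
  lift b to ℕ using hb
  subst H
  rw [← Nat.cast_add, ← Nat.cast_add]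
  simp only [ENat.toNat_natCast]
  push_cast
  ring

theorem ENat.toNat_add_eq_of_add_eq {a b c p q : ℕ∞} (ha : a ≠ ⊤) (hb : b ≠ ⊤) (hc : c ≠ ⊤)
    (hp : p ≠ ⊤) (hq : q ≠ ⊤) (H : a + b = c + (p + q)) :
    (a.toNat : ℚ) + (b.toNat : ℚ) = (c.toNat : ℚ) + ((p.toNat : ℚ) + (q.toNat : ℚ)) := by
  lift a to ℕ using ha
  lift b to ℕ using hb
  lift c to ℕ using hc
  lift p to ℕ using hp
  lift q to ℕ using hq
  exact_mod_cast H

/-- Here `c`, `h` and `r i` stand for the lengths of the chains, of the homology and of the image of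
the differential from degree `i + 1` to degree `i`. The sum telescopes from degree 2 on; degrees 0
and 1 stay unexpanded, since they are evaluated through `R/J` instead. -/
theorem sum_range_neg_one_pow_mul_eq (c r h : ℕ → ℚ)
    (hh : ∀ i, h (i + 1) = c (i + 1) - r i - r (i + 1)) (m : ℕ) (hm : 1 ≤ m) :
    ∑ i ∈ Finset.range (m + 1), (-1 : ℚ) ^ i * c i =
      c 0 - c 1 + r 1 + ∑ i ∈ Finset.Icc 2 m, (-1 : ℚ) ^ i * h i + (-1 : ℚ) ^ m * r m := by
  induction m, hm using Nat.le_induction with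
  | base => simp [Finset.sum_range_succ]; ring
  | succ m hm ih =>
    rw [Finset.sum_range_succ, ih, Finset.sum_Icc_succ_top (by omega), hh m]
    ring

/-- The usual expansion, reindexed so that its `i`-th summand matches the term of degree `i` of the
Kirby–Mehran complex. -/
theorem fwdDiff_iter_eq_sum_range {M : Type*} [AddCommGroup M] (e : M) (f : M → ℚ) (k : ℕ) (n : M) :
    (fwdDiff e)^[k] f n = ∑ i ∈ Finset.range (k + 1),
      (-1 : ℚ) ^ i * (k.choose i * f (n + ((k : ℤ) - (i : ℤ)) • e)) := by
  rw [fwdDiff_iter_eq_sum_shift, ← Finset.sum_range_reflect]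
  refine Finset.sum_congr rfl fun i hi => ?_
  have hi : i ≤ k := Nat.lt_succ_iff.mp (Finset.mem_range.mp hi)
  have e1 : k + 1 - 1 - i = k - i := by omega
  rw [e1, Nat.sub_sub_self hi, Nat.choose_symm hi]
  have e2 : (k - i) • e = ((k : ℤ) - (i : ℤ)) • e := by
    rw [← natCast_zsmul, Nat.cast_sub hi]
  rw [e2, zsmul_eq_mul]
  push_cast
  ring

variable {R : Type u} [CommRing R] {s : ℕ} {I : Fin s → Ideal R}
  (F : MultiFiltration I) {k : ℕ} (y : Fin k → R) (hy : ∀ j, y j ∈ F.ideal 1)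

theorem length_kirbyMehranTerm_ne_top (hF : ∀ m, F.hilbertFunction m ≠ ⊤) (n : Fin s → ℤ) (i : ℕ) :
    Module.length R (KirbyMehranTerm F n k i) ≠ ⊤ := by
  rw [length_kirbyMehranTerm]
  exact WithTop.mul_ne_top (ENat.natCast_ne_top _) (hF _)

theorem length_homology_kirbyMehran_ne_top (hF : ∀ m, F.hilbertFunction m ≠ ⊤) (n : Fin s → ℤ)
    (i : ℕ) : Module.length R ((kirbyMehran F n y hy).homology i) ≠ ⊤ :=
  ne_top_of_le_ne_top (length_kirbyMehranTerm_ne_top F hF n i)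
    (length_homology_kirbyMehran_le F n y hy i)

theorem span_range_mul_le (n : Fin s → ℤ) (hy : ∀ j, y j ∈ F.ideal 1) :
    Ideal.span (Set.range y) * F.ideal n ≤ F.ideal (n + 1) := by
  rw [add_comm]
  refine le_trans (Ideal.mul_mono_left ?_) (F.mul_le 1 n)
  rw [Ideal.span_le]
  rintro _ ⟨j, rfl⟩
  exact hy j

/-- The Euler characteristic of the Kirby-Mehran complex is the `k`-th difference of the Hilbert
function. -/
theorem fwdDiff_iter_hilbertFunction (hk : 1 ≤ k) (hF : ∀ m, F.hilbertFunction m ≠ ⊤)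
    (hJ : Module.length R (R ⧸ Ideal.span (Set.range y)) ≠ ⊤)
    (hJF : ∀ m, Module.length R (R ⧸ Ideal.span (Set.range y) * F.ideal m) ≠ ⊤)
    (hex : KoszulExactMod y ⊥ 0) (n : Fin s → ℤ) :
    (fwdDiff (1 : Fin s → ℤ))^[k] (fun m => ((F.hilbertFunction m).toNat : ℚ)) n =
      ((Module.length R (R ⧸ Ideal.span (Set.range y))).toNat : ℚ) -
      ((quotientLength (F.ideal (n + (k : ℤ) • (1 : Fin s → ℤ)))
          (Ideal.span (Set.range y) * F.ideal (n + ((k : ℤ) - 1) • (1 : Fin s → ℤ)))).toNat : ℚ) +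
      ∑ i ∈ Finset.Icc 2 k, (-1 : ℚ) ^ i *
          ((Module.length R ((kirbyMehran F n y hy).homology i)).toNat : ℚ) := by
  have hT := length_kirbyMehranTerm_ne_top F (k := k) hF n
  have hH := length_homology_kirbyMehran_ne_top F y hy hF n
  have hR : ∀ i, Module.length R (LinearMap.range (kirbyMehranD F n y hy i)) ≠ ⊤ := fun i =>
    ne_top_of_le_ne_top (hT i)
      (Module.length_le_of_injective (Submodule.subtype _) (Submodule.injective_subtype _))
  have hstep : ∀ i, ((Module.length R ((kirbyMehran F n y hy).homology (i + 1))).toNat : ℚ) =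
      ((Module.length R (KirbyMehranTerm F n k (i + 1))).toNat : ℚ) -
      ((Module.length R (LinearMap.range (kirbyMehranD F n y hy i))).toNat : ℚ) -
      ((Module.length R (LinearMap.range (kirbyMehranD F n y hy (i + 1)))).toNat : ℚ) := by
    intro i
    have h1 := LinearMap.length_ker_add_length_range (kirbyMehranD F n y hy i)
    rw [← length_range_add_length_homology_kirbyMehran F n y hy i] at h1
    exact ENat.toNat_eq_sub_sub (hR (i + 1)) (hH (i + 1)) (hR i) h1
  -- The image of the differential leaving degree `k + 1` is zero, as `Fin k` has no subset with `k
  -- + 1` elements.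
  have hlast : ((Module.length R (LinearMap.range (kirbyMehranD F n y hy k))).toNat : ℚ) = 0 := by
    have h0 : Module.length R (KirbyMehranTerm F n k (k + 1)) = 0 := by
      rw [length_kirbyMehranTerm, Nat.choose_eq_zero_of_lt (Nat.lt_succ_self k)]; simp
    have h1 := LinearMap.length_ker_add_length_range (kirbyMehranD F n y hy k)
    rw [h0, add_eq_zero] at h1
    rw [h1.2]; simp
  have hone := length_kirbyMehranTerm_one F n y hy hex
  have hle : Ideal.span (Set.range y) * F.ideal (n + ((k : ℤ) - 1) • (1 : Fin s → ℤ)) ≤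
      F.ideal (n + (k : ℤ) • (1 : Fin s → ℤ)) := by
    refine (span_range_mul_le F y _ hy).trans (le_of_eq (congrArg F.ideal ?_))
    ext t; simp [add_assoc]
  have hq := length_quotient_add_quotientLength hle
  have hqt : quotientLength (F.ideal (n + (k : ℤ) • (1 : Fin s → ℤ)))
      (Ideal.span (Set.range y) * F.ideal (n + ((k : ℤ) - 1) • (1 : Fin s → ℤ))) ≠ ⊤ :=
    ne_top_of_le_ne_top (hJF _) (hq ▸ le_self_add)
  -- Splitting `R / J F(n+(k-1)e)` at `F(n+ke)` produces the length of `R / F(n+ke)`, which cancels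
  -- the degree 0 term in the final sum.
  rw [← hq] at hone
  have hk0 : Module.length R (R ⧸ F.ideal (n + (k : ℤ) • (1 : Fin s → ℤ))) ≠ ⊤ := hF _
  have hone' := ENat.toNat_add_eq_of_add_eq (hT 1) hJ (hR 1) hqt hk0 hone
  rw [fwdDiff_iter_eq_sum_range]
  have hc : ∀ i, (k.choose i : ℚ) *
      ((F.hilbertFunction (n + ((k : ℤ) - (i : ℤ)) • (1 : Fin s → ℤ))).toNat : ℚ) =
      ((Module.length R (KirbyMehranTerm F n k i)).toNat : ℚ) := by
    intro i
    rw [length_kirbyMehranTerm, ENat.toNat_mul]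
    simp
  simp only [hc]
  rw [sum_range_neg_one_pow_mul_eq _
    (fun i => ((Module.length R (LinearMap.range (kirbyMehranD F n y hy i))).toNat : ℚ))
    (fun i => ((Module.length R ((kirbyMehran F n y hy).homology i)).toNat : ℚ)) hstep k hk, hlast]
  have hc0 : ((Module.length R (KirbyMehranTerm F n k 0)).toNat : ℚ) =
      ((Module.length R (R ⧸ F.ideal (n + (k : ℤ) • (1 : Fin s → ℤ)))).toNat : ℚ) := by
    rw [← hc 0, Nat.cast_zero, sub_zero]; simp [MultiFiltration.hilbertFunction]
  rw [hc0]
  linear_combination -hone'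

end EulerCharacteristic

/-! ### Vanishing of higher homology far out on a diagonal ray. -/

section Vanishing

open Filter

variable {R : Type u} [CommRing R] [IsNoetherianRing R] {s : ℕ} {I : Fin s → Ideal R}
  (F : MultiFiltration I) {k : ℕ} (y : Fin k → R) (hy : ∀ j, y j ∈ F.ideal 1)

omit [IsNoetherianRing R] in
theorem eventually_add_nsmul_one {p : (Fin s → ℤ) → Prop} (hp : ∀ᶠ n in atTop, p n)
    (n : Fin s → ℤ) : ∀ᶠ t : ℕ in atTop, p (n + (t : ℤ) • (1 : Fin s → ℤ)) := by
  obtain ⟨N, hN⟩ := eventually_atTop.mp hp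
  refine eventually_atTop.mpr ⟨Finset.univ.sup fun i => (N i - n i).toNat, fun t ht => hN _ ?_⟩
  intro i
  have h1 := (Finset.le_sup (f := fun i => (N i - n i).toNat) (Finset.mem_univ i)).trans ht
  simp only [Pi.add_apply, Pi.smul_apply, Pi.one_apply, smul_eq_mul, mul_one]
  omega

/-- The filtration by the submodules of Koszul chains with coordinates in `F(n + t e)`. -/
def koszulFiltration (n : Fin s → ℤ) (i : ℕ) :
    (Ideal.span (Set.range y)).Filtration (KoszulTerm R k i) where
  N t := Submodule.pi Set.univ fun _ => F.ideal (n + (t : ℤ) • (1 : Fin s → ℤ))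
  mono t := Submodule.pi_mono fun _ _ => F.antitone fun i => by simp
  smul_le t := by
    rw [Submodule.smul_le]
    intro a ha c hc S hS
    have h := span_range_mul_le F y _ hy (Ideal.mul_mem_mul ha (hc S hS))
    refine (congrArg F.ideal ?_).le h
    ext t; simp [add_assoc]

omit [IsNoetherianRing R] in
theorem koszulFiltration_stable
    (hred : ∀ᶠ n in atTop, Ideal.span (Set.range y) * F.ideal n = F.ideal (n + 1))
    (n : Fin s → ℤ) (i : ℕ) : (koszulFiltration F y hy n i).Stable := by
  obtain ⟨T, hT⟩ := eventually_atTop.mp (eventually_add_nsmul_one hred n)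
  refine ⟨T, fun t ht => le_antisymm ((koszulFiltration F y hy n i).smul_le t) fun c hc => ?_⟩
  have h1 : ∀ S, ∃ p : Fin k → R, (∀ j, p j ∈ F.ideal (n + (t : ℤ) • (1 : Fin s → ℤ))) ∧
      c S = ∑ j, y j * p j := by
    intro S
    rw [← mem_span_range_mul_iff, hT t ht]
    refine (congrArg F.ideal ?_).le (hc S trivial)
    ext t; simp [add_assoc]
  choose p hp hpc using h1
  have h2 : c = ∑ j, y j • (fun S => p S j) := by
    funext S
    simp [hpc S]
  rw [h2]
  exact Submodule.sum_mem _ fun j _ => Submodule.smul_mem_smul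
    (Ideal.subset_span (Set.mem_range_self j)) fun S _ => hp S j

/-- Koszul cycles with coordinates in a stable filtration are eventually boundaries of chains with
coordinates in the filtration. -/
theorem eventually_exists_koszulD_eq
    (hred : ∀ᶠ n in atTop, Ideal.span (Set.range y) * F.ideal n = F.ideal (n + 1))
    (hy : ∀ j, y j ∈ F.ideal 1) (n : Fin s → ℤ) (i : ℕ) :
    ∀ᶠ t : ℕ in atTop, ∀ z : KoszulTerm R k (i + 1),
      (∀ S, z S ∈ F.ideal (n + ((t : ℤ) + 1) • (1 : Fin s → ℤ))) → koszulD y i z = 0 →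
      ∃ w, (∀ S, w S ∈ F.ideal (n + (t : ℤ) • (1 : Fin s → ℤ))) ∧ koszulD y (i + 1) w = z := by
  -- Artin–Rees: the induced filtration on the cycles is again stable, so far out a cycle with
  -- coordinates in `F(n+(t+1)e)` is a `J`-combination of cycles with coordinates in `F(n+te)`.
  have hst := (koszulFiltration_stable F y hy hred n (i + 1)).inter_right
    ((Ideal.span (Set.range y)).trivialFiltration (LinearMap.ker (koszulD y i)))
  obtain ⟨T, hT⟩ := hst
  refine eventually_atTop.mpr ⟨T, fun t ht z hz hDz => ?_⟩
  have hzmem : z ∈ (koszulFiltration F y hy n (i + 1) ⊓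
      (Ideal.span (Set.range y)).trivialFiltration (LinearMap.ker (koszulD y i))).N (t + 1) := by
    refine ⟨fun S _ => ?_, hDz⟩
    have := hz S
    push_cast
    exact this
  rw [← hT t ht] at hzmem
  let W : Submodule R (KoszulTerm R k (i + 1)) := Submodule.map (koszulD y (i + 1))
    (Submodule.pi Set.univ fun _ => F.ideal (n + (t : ℤ) • (1 : Fin s → ℤ)))
  have hW : z ∈ W := by
    refine Submodule.smul_le.mpr ?_ hzmem
    rintro a ha c ⟨hc, hc0⟩
    induction ha using Submodule.span_induction with
    | mem x hx =>
      obtain ⟨j, rfl⟩ := hx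
      -- For a cycle `c` the homotopy formula reads `y_j c = D(e_j ∧ c)`, and wedging keeps the
      -- coordinates in the same ideal.
      refine ⟨koszulWedge j (i + 1) c, fun S _ => koszulWedge_mem (fun T => hc T trivial) j S, ?_⟩
      have hw : koszulWedge j i (koszulD y i c) = 0 := by
        rw [LinearMap.mem_ker.mp hc0]
        funext S
        exact (Submodule.mem_bot R).mp (koszulWedge_mem (𝔞 := ⊥) (fun T => by simp) j S)
      have := koszulD_wedge y j i c
      rwa [hw, add_zero] at this
    | zero => rw [zero_smul]; exact W.zero_mem
    | add a b _ _ ha hb => rw [add_smul]; exact W.add_mem ha hb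
    | smul r a _ ha => rw [smul_assoc]; exact W.smul_mem r ha
  obtain ⟨w, hw, hwz⟩ := hW
  exact ⟨w, fun S => hw S trivial, hwz⟩

/-- A cycle of the quotient complex lifts to `c` with `D c` in the subcomplex. Far out, `D c = D w`
with `w` in the subcomplex, so `c - w` is a Koszul cycle on `R` and hence a boundary. Degree at
least 2 is needed for `D c` to live in positive degree. -/
theorem eventually_length_homology_kirbyMehran_eq_zero
    (hred : ∀ᶠ n in atTop, Ideal.span (Set.range y) * F.ideal n = F.ideal (n + 1))
    (hF : ∀ m, F.hilbertFunction m ≠ ⊤) (hex : ∀ i, KoszulExactMod y ⊥ i) (n : Fin s → ℤ) (i : ℕ) :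
    ∀ᶠ t : ℕ in atTop, Module.length R
      ((kirbyMehran F (n + (t : ℤ) • (1 : Fin s → ℤ)) y hy).homology (i + 2)) = 0 := by
  filter_upwards [eventually_exists_koszulD_eq F y hred hy
    (n + ((k : ℤ) - (i + 2)) • (1 : Fin s → ℤ)) i] with t ht
  set m := n + (t : ℤ) • (1 : Fin s → ℤ)
  have hker : LinearMap.ker (kirbyMehranD F m y hy (i + 1)) ≤
      LinearMap.range (kirbyMehranD F m y hy (i + 1 + 1)) := by
    intro c hc
    obtain ⟨c, rfl⟩ := Submodule.mkQ_surjective _ c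
    have hc : Submodule.mkQ (koszulReesPart F m k (i + 1)) (koszulD y (i + 1) c) = 0 := hc
    rw [Submodule.mkQ_apply, Submodule.Quotient.mk_eq_zero] at hc
    obtain ⟨w, hw, hwc⟩ := ht (koszulD y (i + 1) c) (fun S => by
      refine (congrArg F.ideal ?_).le (hc S trivial)
      ext a
      simp only [m, Pi.add_apply, Pi.smul_apply, Pi.one_apply, smul_eq_mul]
      push_cast
      ring) (koszulD_koszulD y i c)
    have hw' : w ∈ koszulReesPart F m k (i + 1 + 1) := fun S _ => by
      refine (congrArg F.ideal ?_).le (hw S)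
      ext a
      simp only [m, Pi.add_apply, Pi.smul_apply, Pi.one_apply, smul_eq_mul]
      push_cast
      ring
    obtain ⟨u, hu⟩ := hex (i + 1) (c - w) (fun T => by rw [map_sub, hwc, sub_self]; simp)
    refine ⟨Submodule.mkQ _ u, ?_⟩
    change Submodule.mkQ _ (koszulD y (i + 1 + 1) u) = _
    have hu' : koszulD y (i + 1 + 1) u = c - w := by
      funext T
      have := hu T
      rw [Ideal.mem_bot, Pi.sub_apply, sub_eq_zero] at this
      exact this.symm
    rw [hu', map_sub, sub_eq_self]
    exact (Submodule.Quotient.mk_eq_zero _).mpr hw'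
  have h1 := length_range_add_length_homology_kirbyMehran F m y hy (i + 1)
  have h2 : Module.length R (LinearMap.ker (kirbyMehranD F m y hy (i + 1))) ≤
      Module.length R (LinearMap.range (kirbyMehranD F m y hy (i + 1 + 1))) :=
    Module.length_le_of_injective (Submodule.inclusion hker) (Submodule.inclusion_injective hker)
  have hR : Module.length R (LinearMap.range (kirbyMehranD F m y hy (i + 1 + 1))) ≠ ⊤ :=
    ne_top_of_le_ne_top (length_kirbyMehranTerm_ne_top F (k := k) hF m (i + 1 + 1))
      (Module.length_le_of_injective (Submodule.subtype _) (Submodule.injective_subtype _))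
  rw [← h1] at h2
  nth_rw 2 [← add_zero (Module.length R (LinearMap.range (kirbyMehranD F m y hy (i + 1 + 1))))] at h2
  exact nonpos_iff_eq_zero.mp ((ENat.add_le_add_iff_left hR).mp h2)

/-- Far out in the direction of `e`, the `k`-th difference of the Hilbert function is the length of
`R / J`. -/
theorem eventually_fwdDiff_iter_hilbertFunction_eq (hk : 1 ≤ k)
    (hred : ∀ᶠ n in atTop, Ideal.span (Set.range y) * F.ideal n = F.ideal (n + 1))
    (hy : ∀ j, y j ∈ F.ideal 1)
    (hF : ∀ m, F.hilbertFunction m ≠ ⊤)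
    (hJ : Module.length R (R ⧸ Ideal.span (Set.range y)) ≠ ⊤)
    (hJF : ∀ m, Module.length R (R ⧸ Ideal.span (Set.range y) * F.ideal m) ≠ ⊤)
    (hex : ∀ i, KoszulExactMod y ⊥ i) (n : Fin s → ℤ) :
    ∀ᶠ t : ℕ in atTop,
      (fwdDiff (1 : Fin s → ℤ))^[k] (fun m => ((F.hilbertFunction m).toNat : ℚ))
        (n + (t : ℤ) • (1 : Fin s → ℤ)) =
      ((Module.length R (R ⧸ Ideal.span (Set.range y))).toNat : ℚ) := by
  have h1 : ∀ᶠ t : ℕ in atTop, ∀ i ∈ Finset.Icc 2 k, Module.length R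
      ((kirbyMehran F (n + (t : ℤ) • (1 : Fin s → ℤ)) y hy).homology i) = 0 := by
    rw [Filter.eventually_all_finset]
    intro i hi
    obtain ⟨j, rfl⟩ := Nat.exists_eq_add_of_le' (Finset.mem_Icc.mp hi).1
    exact eventually_length_homology_kirbyMehran_eq_zero F y hy hred hF hex n j
  have h2 := eventually_add_nsmul_one hred (n + ((k : ℤ) - 1) • (1 : Fin s → ℤ))
  filter_upwards [h1, h2] with t ht1 ht2
  rw [fwdDiff_iter_hilbertFunction F y hy hk hF hJ hJF (hex 0)]
  have e1 : n + (t : ℤ) • (1 : Fin s → ℤ) + ((k : ℤ) - 1) • (1 : Fin s → ℤ) =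
      n + ((k : ℤ) - 1) • (1 : Fin s → ℤ) + (t : ℤ) • (1 : Fin s → ℤ) := by abel
  have e2 : n + (t : ℤ) • (1 : Fin s → ℤ) + (k : ℤ) • (1 : Fin s → ℤ) =
      n + ((k : ℤ) - 1) • (1 : Fin s → ℤ) + (t : ℤ) • (1 : Fin s → ℤ) + 1 := by
    ext a
    simp only [Pi.add_apply, Pi.smul_apply, Pi.one_apply, smul_eq_mul]
    ring
  rw [e1, e2, ht2]
  have hq : ∀ K : Ideal R, quotientLength K K = 0 := by
    intro K
    unfold quotientLength
    rw [Submodule.submoduleOf_self, Module.length_eq_zero_iff]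
    infer_instance
  rw [hq, Finset.sum_eq_zero fun i hi => by rw [ht1 i hi]; simp]
  simp

end Vanishing

/-! ### Functions with vanishing high differences are eventually polynomial. -/

section Differences

theorem fwdDiff_iter_comp {M M' G : Type*} [AddCommMonoid M] [AddCommMonoid M'] [AddCommGroup G]
    {e : M} {e' : M'} {φ : M' → M} (hφ : ∀ b, φ (b + e') = φ b + e) (f : M → G) (k : ℕ) :
    (fwdDiff e')^[k] (f ∘ φ) = (fwdDiff e)^[k] f ∘ φ := by
  induction k generalizing f with
  | zero => rfl
  | succ k ih =>
    rw [Function.iterate_succ_apply, Function.iterate_succ_apply, ← ih]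
    congr 1
    funext b
    simp [fwdDiff, hφ]

theorem fwdDiff_commute {M G : Type*} [AddCommMonoid M] [AddCommGroup G] (e e' : M) :
    Function.Commute (fwdDiff e : (M → G) → M → G) (fwdDiff e') := by
  intro f
  funext n
  simp only [fwdDiff]
  rw [add_right_comm n e e']
  abel

variable {s : ℕ}

/-- A function on `ℕˢ` such that sufficiently high differences in each direction vanish on a
cone `n ≥ N`. -/
def HasVanishingDifferences (f : (Fin s → ℕ) → ℚ) : Prop :=
  ∃ (k : ℕ) (N : Fin s → ℕ), ∀ i, ∀ n, N ≤ n → (fwdDiff (Pi.single i 1))^[k] f n = 0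

theorem fwdDiff_iter_congr {f g : (Fin s → ℕ) → ℚ} {N : Fin s → ℕ} (h : ∀ n, N ≤ n → f n = g n)
    (e : Fin s → ℕ) (k : ℕ) (n : Fin s → ℕ) (hn : N ≤ n) :
    (fwdDiff e)^[k] f n = (fwdDiff e)^[k] g n := by
  rw [fwdDiff_iter_eq_sum_shift, fwdDiff_iter_eq_sum_shift]
  exact Finset.sum_congr rfl fun j _ => by rw [h _ (hn.trans le_self_add)]

theorem fwdDiff_iter_zero (e : Fin s → ℕ) (k : ℕ) :
    (fwdDiff e)^[k] (fun _ => (0 : ℚ)) = fun _ => 0 := by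
  induction k with
  | zero => rfl
  | succ k ih => rw [Function.iterate_succ_apply, fwdDiff_const, ih]

theorem fwdDiff_iter_eq_zero_of_le {f : (Fin s → ℕ) → ℚ} {N e : Fin s → ℕ} {k k' : ℕ} (hk : k ≤ k')
    (h : ∀ n, N ≤ n → (fwdDiff e)^[k] f n = 0) (n : Fin s → ℕ) (hn : N ≤ n) :
    (fwdDiff e)^[k'] f n = 0 := by
  obtain ⟨j, rfl⟩ := Nat.exists_eq_add_of_le' hk
  rw [Function.iterate_add_apply, fwdDiff_iter_congr h e j n hn, fwdDiff_iter_zero]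

namespace HasVanishingDifferences

theorem of_eventually_eq_zero {f : (Fin s → ℕ) → ℚ} {N : Fin s → ℕ} (h : ∀ n, N ≤ n → f n = 0) :
    HasVanishingDifferences f :=
  ⟨0, N, fun _ n hn => h n hn⟩

theorem sub {f g : (Fin s → ℕ) → ℚ} (hf : HasVanishingDifferences f)
    (hg : HasVanishingDifferences g) : HasVanishingDifferences (fun n => f n - g n) := by
  obtain ⟨k, N, hf⟩ := hf
  obtain ⟨k', N', hg⟩ := hg
  refine ⟨max k k', N ⊔ N', fun i n hn => ?_⟩
  have h1 := fwdDiff_iter_eq_zero_of_le (le_max_left k k') (hf i) n (le_sup_left.trans hn)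
  have h2 := fwdDiff_iter_eq_zero_of_le (le_max_right k k') (hg i) n (le_sup_right.trans hn)
  have e : (fun n => f n - g n) = f + (-1 : ℚ) • g := by
    funext n; simp [sub_eq_add_neg]
  rw [e, fwdDiff_iter_add, fwdDiff_iter_const_smul]
  simp [h1, h2]

theorem of_fwdDiff {f : (Fin s → ℕ) → ℚ}
    (h : ∀ i, HasVanishingDifferences (fwdDiff (Pi.single i 1) f)) :
    HasVanishingDifferences f := by
  choose k N hN using h
  refine ⟨Finset.univ.sup k + 1, Finset.univ.sup N, fun i n hn => ?_⟩
  rw [Function.iterate_succ_apply]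
  exact fwdDiff_iter_eq_zero_of_le (Finset.le_sup (Finset.mem_univ i)) (hN i i) n
    ((Finset.le_sup (Finset.mem_univ i)).trans hn)

end HasVanishingDifferences

theorem exists_polynomial_eval_eq_choose (j : ℕ) :
    ∃ p : Polynomial ℚ, ∀ a : ℕ, p.eval (a : ℚ) = a.choose j := by
  refine ⟨Polynomial.C (j.factorial : ℚ)⁻¹ * descPochhammer ℚ j, fun a => ?_⟩
  rw [Polynomial.eval_mul, Polynomial.eval_C, descPochhammer_eval_eq_descFactorial,
    Nat.descFactorial_eq_factorial_mul_choose]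
  have : (j.factorial : ℚ) ≠ 0 := by exact_mod_cast j.factorial_ne_zero
  push_cast
  field_simp

/-- A function on `ℕˢ` whose `k`-th differences in each direction vanish is a polynomial. -/
theorem exists_mvPolynomial_of_fwdDiff_iter_eq_zero (k : ℕ) :
    ∀ {s : ℕ} (g : (Fin s → ℕ) → ℚ), (∀ i n, (fwdDiff (Pi.single i 1))^[k] g n = 0) →
      ∃ P : MvPolynomial (Fin s) ℚ, ∀ n, MvPolynomial.eval (fun i => (n i : ℚ)) P = g n := by
  intro s
  induction s with
  | zero =>
    intro g _
    refine ⟨MvPolynomial.C (g 0), fun n => ?_⟩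
    rw [MvPolynomial.eval_C, Subsingleton.elim n 0]
  | succ s ih =>
    intro g hg
    let e : Fin (s + 1) → ℕ := Pi.single 0 1
    -- The coefficients of Newton's expansion in the variable of index 0: iterated differences in
    -- that direction, restricted to the hyperplane where it is zero. They are polynomials in the
    -- other variables by induction.
    let h : ℕ → (Fin s → ℕ) → ℚ := fun j => (fwdDiff e)^[j] g ∘ fun b => Fin.cons 0 b
    have hh : ∀ j i n, (fwdDiff (Pi.single i 1))^[k] (h j) n = 0 := by
      intro j i n
      have hφ : ∀ b : Fin s → ℕ, (Fin.cons 0 (b + Pi.single i 1) : Fin (s + 1) → ℕ) =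
          Fin.cons 0 b + Pi.single i.succ 1 := by
        intro b
        funext l
        refine Fin.cases ?_ (fun l => ?_) l
        · simp
        · simp [Pi.single_apply]
      rw [fwdDiff_iter_comp hφ, Function.comp_apply,
        ((fwdDiff_commute (Pi.single i.succ 1) e).iterate_iterate k j).eq g]
      have h0 : (fwdDiff (Pi.single i.succ 1))^[k] g = fun _ => 0 := funext fun n => hg _ n
      rw [h0, fwdDiff_iter_zero]
    choose P hP using fun j => ih (h j) (hh j)
    choose b hb using exists_polynomial_eval_eq_choose
    refine ⟨∑ j ∈ Finset.range k, Polynomial.eval₂ MvPolynomial.C (MvPolynomial.X 0) (b j) *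
      MvPolynomial.rename Fin.succ (P j), fun n => ?_⟩
    have hn : n = Fin.cons 0 (Fin.tail n) + n 0 • e := by
      funext l
      refine Fin.cases ?_ (fun l => ?_) l
      · simp [e]
      · simp [e, Fin.tail]
    have hvan : ∀ j, k ≤ j → (fwdDiff e)^[j] g (Fin.cons 0 (Fin.tail n)) = 0 := fun j hj =>
      fwdDiff_iter_eq_zero_of_le (N := 0) hj (fun n _ => hg 0 n) _ zero_le
    have hsum : g n = _ := (congrArg g hn).trans
      (shift_eq_sum_fwdDiff_iter e g (n 0) (Fin.cons 0 (Fin.tail n)))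
    rw [map_sum, hsum]
    have e1 : ∀ j, MvPolynomial.eval (fun i => (n i : ℚ))
        (Polynomial.eval₂ MvPolynomial.C (MvPolynomial.X 0) (b j) *
          MvPolynomial.rename Fin.succ (P j)) =
        (n 0).choose j • (fwdDiff e)^[j] g (Fin.cons 0 (Fin.tail n)) := by
      intro j
      rw [map_mul, MvPolynomial.eval_rename, Polynomial.hom_eval₂, MvPolynomial.eval_X]
      have e2 : (MvPolynomial.eval fun i => (n i : ℚ)).comp MvPolynomial.C = RingHom.id ℚ := by
        ext; simp
      rw [e2, Polynomial.eval₂_id, hb, nsmul_eq_mul]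
      congr 1
      exact hP j (Fin.tail n)
    simp only [e1]
    -- The sums over `j < k` and over `j ≤ n 0` agree: beyond `k` the differences vanish, and beyond
    -- `n 0` the binomial coefficients do.
    have hl := Finset.sum_subset (Finset.range_subset_range.mpr (le_max_left k (n 0 + 1)))
      (f := fun j => (n 0).choose j • (fwdDiff e)^[j] g (Fin.cons 0 (Fin.tail n)))
      fun j _ hj => by rw [hvan j (by simpa using hj), smul_zero]
    have hr := Finset.sum_subset (Finset.range_subset_range.mpr (le_max_right k (n 0 + 1)))
      (f := fun j => (n 0).choose j • (fwdDiff e)^[j] g (Fin.cons 0 (Fin.tail n)))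
      fun j _ hj => by
        rw [Nat.choose_eq_zero_of_lt (by simpa using hj), zero_smul]
    rw [hl, hr]

theorem HasVanishingDifferences.exists_mvPolynomial {f : (Fin s → ℕ) → ℚ}
    (hf : HasVanishingDifferences f) :
    ∃ (P : MvPolynomial (Fin s) ℚ) (N : Fin s → ℕ),
      ∀ n, MvPolynomial.eval (fun i => (n i : ℚ)) P = f (N + n) := by
  obtain ⟨k, N, h⟩ := hf
  obtain ⟨P, hP⟩ := exists_mvPolynomial_of_fwdDiff_iter_eq_zero k (f ∘ (N + ·)) fun i n => by
    rw [fwdDiff_iter_comp (e := Pi.single i 1) (fun b => (add_assoc N b _).symm)]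
    exact h i _ le_self_add
  exact ⟨P, N, hP⟩

end Differences

/-! ### Hilbert functions of Noetherian multigraded subquotients. -/

section GradedSubquotients

variable {R : Type u} [CommRing R] {s : ℕ}

/-- Multiplication by `x` from `B` to `R/A` has kernel `B ∩ (A : x)` and cokernel `R/(A + xB)`. The
identity is written additively, so it needs no finiteness. -/
theorem length_quotient_add_length_quotient_eq (A B : Ideal R) (x : R) :
    Module.length R (R ⧸ A) + Module.length R (R ⧸ B) =
      Module.length R (R ⧸ A ⊔ Submodule.map (LinearMap.mulLeft R x) B) +
        Module.length R (R ⧸ B ⊓ Submodule.comap (LinearMap.mulLeft R x) A) := by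
  set xB : Ideal R := Submodule.map (LinearMap.mulLeft R x) B
  let φ : B →ₗ[R] R ⧸ A := (Submodule.mkQ A).comp ((LinearMap.mulLeft R x).comp B.subtype)
  have hr : LinearMap.range φ = Submodule.map (Submodule.mkQ A) (A ⊔ xB) := by
    rw [Submodule.map_sup, Submodule.mkQ_map_self, bot_sup_eq, LinearMap.range_comp,
      LinearMap.range_comp, Submodule.range_subtype]
  have h1 := Submodule.length_add_length_quotient (LinearMap.range φ)
  have h2 : Module.length R ((R ⧸ A) ⧸ LinearMap.range φ) = Module.length R (R ⧸ A ⊔ xB) := by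
    rw [hr]
    exact (Submodule.quotientQuotientEquivQuotient A (A ⊔ xB) le_sup_left).length_eq
  have h3 : Module.length R (LinearMap.range φ) =
      quotientLength B (B ⊓ Submodule.comap (LinearMap.mulLeft R x) A) := by
    rw [← φ.quotKerEquivRange.length_eq]
    unfold quotientLength
    have hk : LinearMap.ker φ =
        (B ⊓ Submodule.comap (LinearMap.mulLeft R x) A).submoduleOf B := by
      ext b
      rw [LinearMap.mem_ker]
      change Submodule.mkQ A (x * b.1) = 0 ↔ b.1 ∈ B ∧ x * b.1 ∈ A
      rw [Submodule.mkQ_apply, Submodule.Quotient.mk_eq_zero]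
      simp
    rw [hk]
  have h4 := length_quotient_add_quotientLength
    (inf_le_left : B ⊓ Submodule.comap (LinearMap.mulLeft R x) A ≤ B)
  rw [← h1, h2, h3, ← h4]
  ac_rfl

/-- A family of ideals indexed by `ℕˢ` is stable under a set of pairs `(i, x)` if multiplication
by `x` maps the ideal of index `n` into that of index `n + e_i`. -/
def StableUnder (Λ : Set (Fin s × R)) (N : (Fin s → ℕ) → Ideal R) : Prop :=
  ∀ p ∈ Λ, ∀ n, ∀ b ∈ N n, p.2 * b ∈ N (n + Pi.single p.1 1)

/-- The ascending chain condition for the stable families between `A` and `B`. -/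
def StableChainCondition (Λ : Set (Fin s × R)) (A B : (Fin s → ℕ) → Ideal R) : Prop :=
  ∀ c : ℕ → (Fin s → ℕ) → Ideal R, Monotone c →
    (∀ k, A ≤ c k ∧ c k ≤ B ∧ StableUnder Λ (c k)) → ∃ K, ∀ k, K ≤ k → c k = c K

theorem StableChainCondition.mono {Λ : Set (Fin s × R)} {A A' B B' : (Fin s → ℕ) → Ideal R}
    (h : StableChainCondition Λ A B) (hA : A ≤ A') (hB : B' ≤ B) : StableChainCondition Λ A' B' :=
  fun c hc hk => h c hc fun k => ⟨hA.trans (hk k).1, (hk k).2.1.trans hB, (hk k).2.2⟩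

variable {Λ : Set (Fin s × R)} {A B : (Fin s → ℕ) → Ideal R}

/-- When no variable moves in direction `i`, the families equal to `B` where `n i < k` and to `A`
elsewhere are stable and increase with `k`. Where this chain stops, `A` and `B` already coincide. -/
theorem StableChainCondition.exists_eq_of_no_variable (h : StableChainCondition Λ A B)
    (hAB : A ≤ B) (hA : StableUnder Λ A) (hB : StableUnder Λ B) (i : Fin s)
    (hi : ∀ p ∈ Λ, p.1 ≠ i) : ∃ K, ∀ n, K ≤ n i → A n = B n := by
  obtain ⟨K, hK⟩ := h (fun k n => if n i < k then B n else A n)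
    (fun k k' hk n => by
      dsimp only
      split_ifs with h1 h2
      · exact le_rfl
      · omega
      · exact hAB n
      · exact le_rfl)
    (fun k => ⟨fun n => by dsimp only; split_ifs; exacts [hAB n, le_rfl],
      fun n => by dsimp only; split_ifs; exacts [le_rfl, hAB n], fun p hp n b hb => by
        have hpi : (n + Pi.single p.1 1 : Fin s → ℕ) i = n i := by
          simp [(hi p hp).symm]
        dsimp only at hb ⊢
        rw [hpi]
        split_ifs at hb ⊢ with h1
        · exact hB p hp n b hb
        · exact hA p hp n b hb⟩)
  refine ⟨K, fun n hn => ?_⟩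
  have h1 := congrFun (hK (n i + 1) (by omega)) n
  simp only [Nat.lt_succ_self, if_true, hn.not_gt, if_false] at h1
  exact h1.symm

/-- The Hilbert function of a Noetherian multigraded subquotient has vanishing differences. -/
theorem hasVanishingDifferences_length_sub (m : ℕ) :
    ∀ (Λ : Finset (Fin s × R)) (A B : (Fin s → ℕ) → Ideal R), Λ.card = m → A ≤ B →
      StableUnder (Λ : Set (Fin s × R)) A → StableUnder (Λ : Set (Fin s × R)) B →
      StableChainCondition (Λ : Set (Fin s × R)) A B →
      (∀ n, Module.length R (R ⧸ A n) ≠ ⊤) →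
      HasVanishingDifferences fun n =>
        ((Module.length R (R ⧸ A n)).toNat : ℚ) - ((Module.length R (R ⧸ B n)).toNat : ℚ) := by
  classical
  induction m with
  | zero =>
    intro Λ A B hΛ hAB hA hB hacc hfin
    obtain rfl := Finset.card_eq_zero.mp hΛ
    refine HasVanishingDifferences.of_fwdDiff fun i => ?_
    obtain ⟨K, hK⟩ := hacc.exists_eq_of_no_variable hAB hA hB i (by simp)
    refine HasVanishingDifferences.of_eventually_eq_zero (N := fun _ => K) fun n hn => ?_
    have h1 : K ≤ (n + Pi.single i 1 : Fin s → ℕ) i := (hn i).trans (by simp)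
    simp only [fwdDiff]
    rw [hK n (hn i), hK _ h1]
    simp
  | succ m ih =>
    intro Λ A B hΛ hAB hA hB hacc hfin
    refine HasVanishingDifferences.of_fwdDiff fun i => ?_
    by_cases hi : ∀ p ∈ Λ, p.1 ≠ i
    · obtain ⟨K, hK⟩ := hacc.exists_eq_of_no_variable hAB hA hB i hi
      refine HasVanishingDifferences.of_eventually_eq_zero (N := fun _ => K) fun n hn => ?_
      have h1 : K ≤ (n + Pi.single i 1 : Fin s → ℕ) i := (hn i).trans (by simp)
      simp only [fwdDiff]
      rw [hK n (hn i), hK _ h1]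
      simp
    push Not at hi
    obtain ⟨⟨i', x⟩, hp, rfl : i' = i⟩ := hi
    set i := i'
    set e : Fin s → ℕ := Pi.single i 1 with he
    have hcard : (Λ.erase (i, x)).card = m := by rw [Finset.card_erase_of_mem hp, hΛ]; rfl
    have hsub : ∀ p ∈ Λ.erase (i, x), p ∈ Λ := fun p hp => Finset.mem_of_mem_erase hp
    have hins : ∀ p ∈ Λ, p = (i, x) ∨ p ∈ Λ.erase (i, x) := fun p hp' => by
      by_cases h : p = (i, x)
      · exact Or.inl h
      · exact Or.inr (Finset.mem_erase.mpr ⟨h, hp'⟩)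
    -- Multiplication by `x` maps `B/A` to its shift by `e_i`, with kernel `K/A` and cokernel `B(· +
    -- e)/C`. Both are annihilated by `x`, so one variable can be dropped, and the difference of the
    -- Hilbert function in direction `i` is that of the cokernel minus that of the kernel.
    let K : (Fin s → ℕ) → Ideal R := fun n =>
      B n ⊓ Submodule.comap (LinearMap.mulLeft R x) (A (n + e))
    let C : (Fin s → ℕ) → Ideal R := fun n =>
      A (n + e) ⊔ Submodule.map (LinearMap.mulLeft R x) (B n)
    have hAK : A ≤ K := fun n b hb => ⟨hAB n hb, hA _ hp n b hb⟩
    have hKB : K ≤ B := fun n => inf_le_left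
    have hAC : ∀ n, A (n + e) ≤ C n := fun n => le_sup_left
    have hCB : C ≤ fun n => B (n + e) := fun n => by
      refine sup_le (hAB _) ?_
      rintro _ ⟨b, hb, rfl⟩
      exact hB _ hp n b hb
    have hxB : ∀ n, ∀ b ∈ B n, x * b ∈ C n := fun n b hb =>
      Submodule.mem_sup_right ⟨b, hb, rfl⟩
    have hK : StableUnder (Λ : Set (Fin s × R)) K := by
      rintro p hp' n b ⟨hb1, hb2⟩
      refine ⟨hB p hp' n b hb1, ?_⟩
      have h1 : p.2 * (x * b) ∈ A (n + e + Pi.single p.1 1) := hA p hp' _ _ hb2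
      rw [add_right_comm, mul_left_comm] at h1
      exact h1
    have hC : StableUnder (Λ : Set (Fin s × R)) C := by
      intro p hp' n b hb
      obtain ⟨a, ha, _, ⟨b', hb', rfl⟩, rfl⟩ := Submodule.mem_sup.mp hb
      rw [mul_add]
      refine Submodule.add_mem _ (Submodule.mem_sup_left ?_) (Submodule.mem_sup_right ?_)
      · rw [add_right_comm]; exact hA p hp' _ _ ha
      · exact ⟨p.2 * b', hB p hp' _ _ hb', by simp [mul_left_comm]⟩
    have hB' : StableUnder (Λ : Set (Fin s × R)) fun n => B (n + e) := by
      intro p hp' n b hb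
      have := hB p hp' _ b hb
      rwa [add_right_comm] at this
    have haccK : StableChainCondition ((Λ.erase (i, x) : Finset _) : Set (Fin s × R)) A K := by
      intro c hc hk
      -- Stability under `x` is automatic, since `x` maps `K` into `A`.
      refine hacc c hc fun k => ⟨(hk k).1, (hk k).2.1.trans hKB, fun p hp' n b hb => ?_⟩
      rcases hins p hp' with rfl | h
      · exact (hk k).1 _ ((hk k).2.1 n hb).2
      · exact (hk k).2.2 p h n b hb
    have haccC : StableChainCondition ((Λ.erase (i, x) : Finset _) : Set (Fin s × R)) C
        fun n => B (n + e) := by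
      intro c hc hk
      have hn1 : ∀ n : Fin s → ℕ, n i ≠ 0 → n - e + e = n := fun n hn => by
        refine tsub_add_cancel_of_le fun l => ?_
        by_cases hl : l = i
        · rw [hl]; simp [he]; omega
        · simp [he, hl]
      -- A chain between `C` and the shift of `B` is moved back by `e` and filled with `A` on the
      -- hyperplane `n i = 0`, giving a chain between `A` and `B`; it is stable under `x` because `x
      -- B(n) ⊆ C(n)`.
      obtain ⟨T, hT⟩ := hacc (fun k n => if n i = 0 then A n else c k (n - e))
        (fun k k' hkk n => by
          dsimp only
          split_ifs
          · exact le_rfl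
          · exact hc hkk _)
        (fun k => by
          refine ⟨fun n => ?_, fun n => ?_, fun p hp' n b hb => ?_⟩
          · dsimp only
            split_ifs with h
            · exact le_rfl
            · refine le_trans ?_ ((hAC _).trans ((hk k).1 (n - e)))
              rw [hn1 n h]
          · dsimp only
            split_ifs with h
            · exact hAB n
            · refine ((hk k).2.1 (n - e)).trans ?_
              dsimp only
              rw [hn1 n h]
          · dsimp only at hb ⊢
            by_cases h : n i = 0
            · rw [if_pos h] at hb
              have h1 := hA p hp' n b hb
              split_ifs with h2
              · exact h1
              · refine (hk k).1 _ (hAC _ ?_)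
                rwa [hn1 _ h2]
            · rw [if_neg h] at hb
              have h2 : (n + Pi.single p.1 1 : Fin s → ℕ) i ≠ 0 := by
                simp only [Pi.add_apply]; omega
              rw [if_neg h2]
              have h3 : n + Pi.single p.1 1 - e = n - e + Pi.single p.1 1 := by
                conv_lhs => rw [← hn1 n h, add_right_comm, add_tsub_cancel_right]
              rw [h3]
              rcases hins p hp' with rfl | h4
              · refine (hk k).1 _ (hxB _ _ ?_)
                exact (hk k).2.1 _ hb
              · exact (hk k).2.2 p h4 _ b hb)
      refine ⟨T, fun k hkT => funext fun n => ?_⟩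
      have h1 := congrFun (hT k hkT) (n + e)
      have h2 : (n + e) i ≠ 0 := by simp [he]
      simpa only [if_neg h2, add_tsub_cancel_right] using h1
    have hfinle : ∀ {P Q : Ideal R}, P ≤ Q → Module.length R (R ⧸ P) ≠ ⊤ →
        Module.length R (R ⧸ Q) ≠ ⊤ := fun h hP =>
      ne_top_of_le_ne_top hP (Module.length_le_of_surjective _ (Submodule.factor_surjective h))
    have ihK := ih (Λ.erase (i, x)) A K hcard hAK (fun p h => hA p (hsub p h))
      (fun p h => hK p (hsub p h)) haccK hfin
    have ihC := ih (Λ.erase (i, x)) C (fun n => B (n + e)) hcard hCB (fun p h => hC p (hsub p h))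
      (fun p h => hB' p (hsub p h)) haccC fun n => hfinle (hAC n) (hfin _)
    convert ihC.sub ihK using 1
    funext n
    have hlen := length_quotient_add_length_quotient_eq (A (n + e)) (B n) x
    have h1 : Module.length R (R ⧸ B n) ≠ ⊤ := hfinle (hAB n) (hfin n)
    have h2 : Module.length R (R ⧸ C n) ≠ ⊤ := hfinle (hAC n) (hfin _)
    have h3 : Module.length R (R ⧸ K n) ≠ ⊤ := hfinle (hAK n) (hfin n)
    have hlen' := congrArg (fun z : ℕ∞ => z.toNat) hlen
    rw [ENat.toNat_add (hfin _) h1, ENat.toNat_add h2 h3] at hlen'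
    have hlen'' : ((Module.length R (R ⧸ A (n + e))).toNat : ℚ) +
        ((Module.length R (R ⧸ B n)).toNat : ℚ) = ((Module.length R (R ⧸ C n)).toNat : ℚ) +
        ((Module.length R (R ⧸ K n)).toNat : ℚ) := by exact_mod_cast hlen'
    simp only [fwdDiff]
    linear_combination hlen''

end GradedSubquotients

/-! ### Noetherianity of the multi-Rees module. -/

section Rees

variable {R : Type u} [CommRing R] {s : ℕ}

/-- The algebra generated by the monomials `x t_i`, for `(i, x)` in a finite set. -/
noncomputable def monomialSubalgebra (Λ : Finset (Fin s × R)) :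
    Subalgebra R (AddMonoidAlgebra R (Fin s → ℕ)) :=
  Algebra.adjoin R ((fun p : Fin s × R => AddMonoidAlgebra.single (Pi.single p.1 1) p.2) '' Λ)

instance [IsNoetherianRing R] (Λ : Finset (Fin s × R)) :
    IsNoetherianRing (monomialSubalgebra Λ) := by
  have : (monomialSubalgebra Λ).FG := Subalgebra.fg_def.mpr ⟨_, Λ.finite_toSet.image _, rfl⟩
  have := (Subalgebra.fg_iff_finiteType _).mp this
  exact Algebra.FiniteType.isNoetherianRing R _

/-- The coefficients `u` for which `u tⁿ` lies in the algebra generated by the monomials. -/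
noncomputable def monomialCoeff (Λ : Finset (Fin s × R)) (n : Fin s → ℕ) : Ideal R where
  carrier := {u | AddMonoidAlgebra.single n u ∈ monomialSubalgebra Λ}
  add_mem' {u v} hu hv := by
    change AddMonoidAlgebra.single n (u + v) ∈ monomialSubalgebra Λ
    rw [AddMonoidAlgebra.single_add]
    exact Subalgebra.add_mem _ hu hv
  zero_mem' := by
    change AddMonoidAlgebra.single n 0 ∈ monomialSubalgebra Λ
    rw [AddMonoidAlgebra.single_zero]
    exact Subalgebra.zero_mem _
  smul_mem' r u hu := by
    change AddMonoidAlgebra.single n (r * u) ∈ monomialSubalgebra Λ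
    rw [← smul_eq_mul, ← AddMonoidAlgebra.smul_single]
    exact Subalgebra.smul_mem _ hu r

theorem mem_monomialCoeff {Λ : Finset (Fin s × R)} {n : Fin s → ℕ} {u : R} :
    u ∈ monomialCoeff Λ n ↔ AddMonoidAlgebra.single n u ∈ monomialSubalgebra Λ := Iff.rfl

theorem monomialCoeff_mul_le (Λ : Finset (Fin s × R)) (m n : Fin s → ℕ) :
    monomialCoeff Λ m * monomialCoeff Λ n ≤ monomialCoeff Λ (m + n) := by
  rw [Ideal.mul_le]
  intro u hu v hv
  rw [mem_monomialCoeff, ← AddMonoidAlgebra.single_mul_single]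
  exact Subalgebra.mul_mem _ hu hv

theorem prod_pow_le_monomialCoeff {Λ : Finset (Fin s × R)} {I : Fin s → Ideal R}
    (hI : ∀ i, I i ≤ Ideal.span {x | (i, x) ∈ Λ}) (n : Fin s → ℕ) :
    ∏ i, I i ^ n i ≤ monomialCoeff Λ n := by
  have hone : (1 : Ideal R) ≤ monomialCoeff Λ 0 := by
    rw [Ideal.one_eq_top, top_le_iff, Ideal.eq_top_iff_one, mem_monomialCoeff]
    exact Subalgebra.one_mem _
  have h1 : ∀ i, I i ≤ monomialCoeff Λ (Pi.single i 1) := fun i => by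
    refine (hI i).trans (Ideal.span_le.mpr fun x hx => ?_)
    exact Algebra.subset_adjoin ⟨(i, x), hx, rfl⟩
  have h2 : ∀ i k, I i ^ k ≤ monomialCoeff Λ (Pi.single i k) := fun i k => by
    induction k with
    | zero => simpa using hone
    | succ k ih =>
      rw [pow_succ, Pi.single_add]
      exact (Ideal.mul_mono ih (h1 i)).trans (monomialCoeff_mul_le Λ _ _)
  have h3 : ∀ S : Finset (Fin s),
      ∏ i ∈ S, I i ^ n i ≤ monomialCoeff Λ (∑ i ∈ S, Pi.single i (n i)) := fun S => by
    classical
    induction S using Finset.induction_on with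
    | empty => simpa using hone
    | insert i S hi ih =>
      rw [Finset.prod_insert hi, Finset.sum_insert hi]
      exact (Ideal.mul_mono (h2 i _) ih).trans (monomialCoeff_mul_le Λ _ _)
  have := h3 Finset.univ
  rwa [Finset.univ_sum_single] at this

/-- A stable family of ideals as a module over the algebra generated by the monomials. -/
noncomputable def familySubmodule {Λ : Finset (Fin s × R)} {N : (Fin s → ℕ) → Ideal R}
    (hN : StableUnder (Λ : Set (Fin s × R)) N) :
    Submodule (monomialSubalgebra Λ) (AddMonoidAlgebra R (Fin s → ℕ)) where
  carrier := {f | ∀ n, f.coeff n ∈ N n}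
  add_mem' {f g} hf hg n := by simpa using (N n).add_mem (hf n) (hg n)
  zero_mem' n := by simp
  smul_mem' := by
    rintro ⟨a, ha⟩ f hf
    change a * f ∈ {f : AddMonoidAlgebra R (Fin s → ℕ) | ∀ n, f.coeff n ∈ N n}
    induction ha using Algebra.adjoin_induction generalizing f with
    | mem a ha =>
      obtain ⟨p, hp, rfl⟩ := ha
      intro n
      classical
      rw [AddMonoidAlgebra.coeff_mul]
      simp only [Finsupp.sum, AddMonoidAlgebra.coeff_single]
      refine Ideal.sum_mem _ fun a ha => Ideal.sum_mem _ fun b _ => ?_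
      split_ifs with h
      · have ha' := Finset.mem_singleton.mp (Finsupp.support_single_subset ha)
        subst ha'
        rw [← h, Finsupp.single_eq_same, add_comm]
        exact hN p hp b _ (hf b)
      · exact Ideal.zero_mem _
    | algebraMap r =>
      intro n
      rw [← Algebra.smul_def, AddMonoidAlgebra.coeff_smul_apply]
      exact (N n).mul_mem_left r (hf n)
    | add a b _ _ ha hb =>
      intro n
      rw [add_mul]
      simpa using (N n).add_mem (ha hf n) (hb hf n)
    | mul a b _ _ ha hb =>
      rw [mul_assoc]
      exact ha (hb hf)

theorem mem_familySubmodule {Λ : Finset (Fin s × R)} {N : (Fin s → ℕ) → Ideal R}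
    {hN : StableUnder (Λ : Set (Fin s × R)) N} {f : AddMonoidAlgebra R (Fin s → ℕ)} :
    f ∈ familySubmodule hN ↔ ∀ n, f.coeff n ∈ N n := Iff.rfl

theorem single_mem_familySubmodule {Λ : Finset (Fin s × R)} {N : (Fin s → ℕ) → Ideal R}
    {hN : StableUnder (Λ : Set (Fin s × R)) N} {n : Fin s → ℕ} {b : R} :
    AddMonoidAlgebra.single n b ∈ familySubmodule hN ↔ b ∈ N n := by
  classical
  rw [mem_familySubmodule]
  constructor
  · intro h
    simpa using h n
  · intro h m
    rw [AddMonoidAlgebra.coeff_single, Finsupp.single_apply]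
    split_ifs with hm
    · rwa [← hm]
    · exact Ideal.zero_mem _

/-- The multi-Rees module `⨁ Iⁿ 𝔟` is Noetherian. -/
theorem stableChainCondition_prod_pow_mul [IsNoetherianRing R] {Λ : Finset (Fin s × R)}
    {I : Fin s → Ideal R} (hI : ∀ i, I i ≤ Ideal.span {x | (i, x) ∈ Λ}) (𝔟 : Ideal R) :
    StableChainCondition (Λ : Set (Fin s × R)) ⊥ fun n => (∏ i, I i ^ n i) * 𝔟 := by
  intro c hc hk
  obtain ⟨G, hG⟩ := IsNoetherian.noetherian (R := R) 𝔟
  -- Generators of `𝔟`, placed in degree 0, generate a finite module over a Noetherian algebra, and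
  -- it contains `I^n 𝔟` in every degree `n`.
  let W : Submodule (monomialSubalgebra Λ) (AddMonoidAlgebra R (Fin s → ℕ)) :=
    Submodule.span _ ((fun g => AddMonoidAlgebra.single 0 g) '' (G : Set R))
  have hW0 : ∀ b ∈ 𝔟, AddMonoidAlgebra.single 0 b ∈ W := by
    intro b hb
    rw [← hG] at hb
    induction hb using Submodule.span_induction with
    | mem g hg => exact Submodule.subset_span ⟨g, hg, rfl⟩
    | zero => rw [AddMonoidAlgebra.single_zero]; exact W.zero_mem
    | add u v _ _ hu hv => rw [AddMonoidAlgebra.single_add]; exact W.add_mem hu hv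
    | smul r u _ hu =>
      have := W.smul_mem (algebraMap R (monomialSubalgebra Λ) r) hu
      rwa [algebraMap_smul, AddMonoidAlgebra.smul_single] at this
  have hWn : ∀ n, ∀ b ∈ (∏ i, I i ^ n i) * 𝔟, AddMonoidAlgebra.single n b ∈ W := by
    intro n b hb
    induction hb using Submodule.mul_induction_on' with
    | mem_mul_mem u hu v hv =>
      have h1 := W.smul_mem ⟨_, prod_pow_le_monomialCoeff hI n hu⟩ (hW0 v hv)
      have h2 : AddMonoidAlgebra.single n u * AddMonoidAlgebra.single 0 v ∈ W := h1
      rwa [AddMonoidAlgebra.single_mul_single, add_zero] at h2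
    | add u _ v _ hu hv => rw [AddMonoidAlgebra.single_add]; exact W.add_mem hu hv
  have : IsNoetherian (monomialSubalgebra Λ) W :=
    isNoetherian_of_fg_of_noetherian W (Submodule.fg_span (G.finite_toSet.image _))
  -- A stable family below `I^n 𝔟` is determined by its submodule of `W`, since its homogeneous
  -- elements lie in `W`; so the chain of families stops with the chain of submodules.
  let f : ℕ →o Submodule (monomialSubalgebra Λ) W :=
    ⟨fun k => (familySubmodule (hk k).2.2).comap W.subtype,
      fun k k' hkk x hx n => hc hkk n (hx n)⟩
  obtain ⟨K, hK⟩ := monotone_stabilizes_iff_noetherian.mpr this f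
  refine ⟨K, fun k hkK => funext fun n => le_antisymm (fun b hb => ?_) (hc hkK n)⟩
  have hbW := hWn n b ((hk k).2.1 n hb)
  have h1 : (⟨_, hbW⟩ : W) ∈ f k :=
    (single_mem_familySubmodule (hN := (hk k).2.2)).mpr hb
  rw [← hK k hkK] at h1
  exact (single_mem_familySubmodule (hN := (hk K).2.2)).mp h1

end Rees

/-! ### Existence of the Hilbert polynomial. -/

section HilbertPolynomial

open Filter

variable {R : Type u} [CommRing R] {s : ℕ} {I : Fin s → Ideal R}

theorem idealMonomial_add_of_nonneg (I : Fin s → Ideal R) {m n : Fin s → ℤ} (hm : 0 ≤ m)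
    (hn : 0 ≤ n) : idealMonomial I (m + n) = idealMonomial I m * idealMonomial I n := by
  unfold idealMonomial
  rw [← Finset.prod_mul_distrib]
  refine Finset.prod_congr rfl fun i _ => ?_
  rw [← pow_add, Pi.add_apply, Int.toNat_add (hm i) (hn i)]

theorem idealMonomial_natCast (I : Fin s → Ideal R) (n : Fin s → ℕ) :
    idealMonomial I (fun i => (n i : ℤ)) = ∏ i, I i ^ n i := by
  simp [idealMonomial]

/-- Far out, an admissible filtration is generated by one of its ideals. -/
theorem MultiFiltration.IsAdmissible.exists_ideal_add_eq {F : MultiFiltration I}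
    (hF : F.IsAdmissible) : ∃ m : Fin s → ℤ, ∀ n : Fin s → ℕ,
      F.ideal (m + fun i => (n i : ℤ)) = (∏ i, I i ^ n i) * F.ideal m := by
  let _ := (Subalgebra.inclusion F.extendedRees_adic_le).toRingHom.toAlgebra
  have hfin : Module.Finite (MultiFiltration.adic I).extendedRees F.extendedRees := hF.finite
  obtain ⟨G, hG⟩ := hfin.fg_top
  classical
  let S : Finset (Fin s → ℤ) := G.biUnion fun g => g.1.coeff.support
  -- `m` bounds the degrees of all homogeneous components of a finite generating set of the extended
  -- Rees ring of `F`.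
  obtain ⟨m, hm⟩ := S.exists_le
  refine ⟨m, fun n => le_antisymm (fun b hb => ?_) ?_⟩
  · let ν : Fin s → ℤ := fun i => (n i : ℤ)
    have hν : 0 ≤ ν := fun i => Int.natCast_nonneg _
    have key : ∀ f : F.extendedRees, f.1.coeff (m + ν) ∈ idealMonomial I ν * F.ideal m := by
      intro f
      have hf : f ∈ Submodule.span (MultiFiltration.adic I).extendedRees (G : Set F.extendedRees) :=
        hG ▸ Submodule.mem_top
      have hgen : ∀ (a : (MultiFiltration.adic I).extendedRees) (g : F.extendedRees), g ∈ G →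
          (a • g).1.coeff (m + ν) ∈ idealMonomial I ν * F.ideal m := by
        intro a g hg
        have e : (a • g).1 = a.1 * g.1 := rfl
        rw [e, AddMonoidAlgebra.coeff_mul]
        simp only [Finsupp.sum]
        refine Ideal.sum_mem _ fun p _ => Ideal.sum_mem _ fun q hq => ?_
        split_ifs with h
        · have hqm : q ≤ m := hm q (Finset.mem_biUnion.mpr ⟨g, hg, hq⟩)
          -- As `m - q` is nonnegative, `I^p = I^ν I^(m-q)`, and the factor `I^(m-q)` carries `F(q)`
          -- into `F(m)`.
          have hp : p = ν + (m - q) := by rw [eq_sub_of_add_eq h]; abel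
          have h1 : a.1.coeff p ∈ idealMonomial I ν * idealMonomial I (m - q) := by
            rw [← idealMonomial_add_of_nonneg I hν (sub_nonneg.mpr hqm), ← hp]
            exact a.2 p
          have h2 := Ideal.mul_mem_mul h1 (g.2 q)
          refine (?_ : idealMonomial I ν * idealMonomial I (m - q) * F.ideal q ≤ _) h2
          rw [mul_assoc]
          refine Ideal.mul_mono_right ((Ideal.mul_mono_left (F.monomial_le _)).trans ?_)
          refine (F.mul_le _ _).trans (le_of_eq ?_)
          rw [sub_add_cancel]
        · exact Ideal.zero_mem _
      induction hf using Submodule.closure_induction with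
      | zero => exact Ideal.zero_mem _
      | add f g _ _ hf hg => exact Ideal.add_mem _ hf hg
      | smul_mem a g hg => exact hgen a g hg
    have hb' : AddMonoidAlgebra.single (m + ν) b ∈ F.extendedRees := by
      intro q
      rw [AddMonoidAlgebra.coeff_single, Finsupp.single_apply]
      split_ifs with hq
      · rw [← hq]; exact hb
      · exact Ideal.zero_mem _
    have := key ⟨_, hb'⟩
    rw [idealMonomial_natCast] at this
    simpa using this
  · rw [← idealMonomial_natCast, add_comm]
    exact (Ideal.mul_mono_left (F.monomial_le _)).trans (F.mul_le _ _)

/-- The Hilbert polynomial of an admissible filtration by ideals of finite colength exists. -/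
theorem MultiFiltration.IsAdmissible.exists_isHilbertPolynomial [IsNoetherianRing R]
    {F : MultiFiltration I} (hF : F.IsAdmissible) (hfin : ∀ n, F.hilbertFunction n ≠ ⊤) :
    ∃ P, F.IsHilbertPolynomial P := by
  classical
  obtain ⟨m, hm⟩ := hF.exists_ideal_add_eq
  choose g hg using fun i => IsNoetherian.noetherian (R := R) (I i)
  let Λ : Finset (Fin s × R) := Finset.univ.biUnion fun i => (g i).image fun x => (i, x)
  have hΛ : ∀ i x, (i, x) ∈ Λ ↔ x ∈ g i := by
    intro i x; simp [Λ]
  have hI : ∀ i, I i ≤ Ideal.span {x | (i, x) ∈ Λ} := fun i => by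
    rw [← hg i]
    exact Ideal.span_mono fun x hx => (hΛ i x).mpr hx
  let B : (Fin s → ℕ) → Ideal R := fun n => F.ideal (m + fun i => (n i : ℤ))
  have hmem : ∀ p ∈ Λ, p.2 ∈ I p.1 := fun p hp => by
    rw [← hg p.1]
    exact Submodule.subset_span ((hΛ p.1 p.2).mp hp)
  have hBs : ∀ l : Fin s → ℕ, StableUnder (Λ : Set (Fin s × R)) fun n => B (n + l) := by
    intro l p hp n b hb
    have h1 : p.2 ∈ F.ideal (fun i => ((Pi.single p.1 1 : Fin s → ℕ) i : ℤ)) := by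
      refine F.monomial_le _ ?_
      rw [idealMonomial_natCast, Finset.prod_eq_single_of_mem p.1 (Finset.mem_univ _)]
      · simpa using hmem p hp
      · intro i _ hi; simp [hi]
    refine (congrArg F.ideal ?_).le (F.mul_le _ _ (Ideal.mul_mem_mul h1 hb))
    ext i
    simp only [Pi.add_apply]
    push_cast
    ring
  have hacc : StableChainCondition (Λ : Set (Fin s × R)) ⊥ B := by
    have := stableChainCondition_prod_pow_mul hI (F.ideal m)
    simp only [← hm] at this
    exact this
  have hvan : HasVanishingDifferences fun n => ((Module.length R (R ⧸ B n)).toNat : ℚ) := by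
    refine HasVanishingDifferences.of_fwdDiff fun i => ?_
    have hle : (fun n => B (n + Pi.single i 1)) ≤ B := fun n => F.antitone fun j => by simp
    have h0 := hBs 0
    simp only [add_zero] at h0
    -- The difference of `λ(R/B n)` in direction `i` is the length of `B(n) / B(n + e_i)`, so the
    -- lower family is `B` shifted by `e_i`.
    exact hasVanishingDifferences_length_sub Λ.card Λ (fun n => B (n + Pi.single i 1)) B rfl hle
      (hBs _) h0 (hacc.mono bot_le le_rfl) fun n => hfin _
  obtain ⟨P, N, hP⟩ := hvan.exists_mvPolynomial
  -- `P` describes lengths relative to the base point `m + N`; the substitution moves the origin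
  -- back.
  refine ⟨MvPolynomial.bind₁ (fun i => MvPolynomial.X i - MvPolynomial.C ((m i + N i : ℤ) : ℚ)) P,
    eventually_atTop.mpr ⟨m + fun i => (N i : ℤ), fun n hn => ⟨hfin n, ?_⟩⟩⟩
  have hn' : ∀ i, m i + N i ≤ n i := hn
  have h1 := hP fun i => (n i - (m i + N i)).toNat
  have e1 : ∀ i, (((n i - (m i + N i)).toNat : ℕ) : ℤ) = n i - (m i + N i) := fun i =>
    Int.toNat_of_nonneg (sub_nonneg.mpr (hn' i))
  have e2 : B (N + fun i => (n i - (m i + N i)).toNat) = F.ideal n := by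
    refine congrArg F.ideal ?_
    ext i
    simp only [Pi.add_apply]
    push_cast
    rw [e1]
    ring
  rw [e2] at h1
  unfold MultiFiltration.hilbertFunction
  rw [← h1, ← MvPolynomial.coe_aeval_eq_eval, ← MvPolynomial.coe_aeval_eq_eval]
  change MvPolynomial.aeval _ (MvPolynomial.bind₁ _ P) = MvPolynomial.aeval _ P
  rw [MvPolynomial.aeval_bind₁]
  congr 2
  funext i
  have := congrArg (fun z : ℤ => (z : ℚ)) (e1 i)
  simp only [Int.cast_natCast] at this
  rw [this]
  simp

end HilbertPolynomial

/-! ### Finiteness of the lengths. -/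

section MaximalPrimary

open IsLocalRing

variable {R : Type u} [CommRing R] [IsLocalRing R] [IsNoetherianRing R]

/-- A prime of `R/K` pulls back to one containing a power of the maximal ideal, hence to the maximal
ideal itself; so the Noetherian ring `R/K` is Artinian. -/
theorem length_quotient_ne_top_of_pow_maximalIdeal_le {K : Ideal R} {N : ℕ}
    (h : maximalIdeal R ^ N ≤ K) : Module.length R (R ⧸ K) ≠ ⊤ := by
  have hdim : Ring.KrullDimLE 0 (R ⧸ K) := Ring.krullDimLE_zero_iff.mpr fun P hP => by
    have h1 : (P.comap (Ideal.Quotient.mk K)).IsPrime := Ideal.IsPrime.comap _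
    have hK : K ≤ P.comap (Ideal.Quotient.mk K) := fun x hx => by
      rw [Ideal.mem_comap, Ideal.Quotient.eq_zero_iff_mem.mpr hx]
      exact P.zero_mem
    have h2 : maximalIdeal R ≤ P.comap (Ideal.Quotient.mk K) :=
      Ideal.IsPrime.le_of_pow_le (h.trans hK)
    have h3 : (P.comap (Ideal.Quotient.mk K)).IsMaximal := by
      rw [← (maximalIdeal.isMaximal R).eq_of_le h1.ne_top h2]
      exact maximalIdeal.isMaximal R
    rw [← Ideal.map_comap_of_surjective _ Ideal.Quotient.mk_surjective P]
    refine Ideal.IsMaximal.map_of_surjective_of_ker_le Ideal.Quotient.mk_surjective ?_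
    rwa [Ideal.mk_ker]
  have hart : IsArtinianRing (R ⧸ K) := IsNoetherianRing.isArtinianRing_of_krullDimLE_zero
  have : IsArtinian R (R ⧸ K) :=
    isArtinian_of_surjective_algebraMap (Ideal.Quotient.mk_surjective (I := K))
  exact Module.length_ne_top

theorem IsMaximalPrimary.exists_pow_le {I : Ideal R} (hI : IsMaximalPrimary I) :
    ∃ N, maximalIdeal R ^ N ≤ I := by
  rw [← hI.2]
  exact Ideal.exists_radical_pow_le_of_fg I (IsNoetherian.noetherian _)

variable {s : ℕ} {I : Fin s → Ideal R}

theorem MultiFiltration.exists_pow_le (F : MultiFiltration I) (hI : ∀ i, IsMaximalPrimary (I i))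
    (n : Fin s → ℤ) : ∃ N, maximalIdeal R ^ N ≤ F.ideal n := by
  choose N hN using fun i => (hI i).exists_pow_le
  refine ⟨∑ i, N i * (n i).toNat, le_trans ?_ (F.monomial_le n)⟩
  rw [← Finset.prod_pow_eq_pow_sum]
  refine Finset.prod_le_prod' fun i _ => ?_
  rw [pow_mul]
  exact Ideal.pow_right_mono (hN i) _

end MaximalPrimary

/-! ### Differences of a polynomial along a diagonal ray. -/

section Difference

open Filter

variable {s : ℕ}

/-- The difference of a polynomial function in the direction of a diagonal is determined by its
values far out on that diagonal. -/
theorem fwdDiff_iter_eval_eq_of_eventually (P : MvPolynomial (Fin s) ℚ) (d : ℕ) (n : Fin s → ℤ)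
    (c : ℚ)
    (h : ∀ᶠ t : ℕ in atTop, (fwdDiff (1 : Fin s → ℤ))^[d]
      (fun m => MvPolynomial.eval (fun i => (m i : ℚ)) P) (n + (t : ℤ) • (1 : Fin s → ℤ)) = c) :
    (fwdDiff (1 : Fin s → ℤ))^[d] (fun m => MvPolynomial.eval (fun i => (m i : ℚ)) P) n = c := by
  -- `p i` is `P` at `n + te + (d-i)e` as a polynomial in `t`; their signed binomial sum `q` is the
  -- `d`-th difference along the ray.
  let p : ℕ → Polynomial ℚ := fun i => MvPolynomial.aeval
    (fun l => Polynomial.X + Polynomial.C ((n l : ℚ) + ((d : ℚ) - (i : ℚ)))) P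
  let q : Polynomial ℚ := ∑ i ∈ Finset.range (d + 1),
    Polynomial.C ((-1 : ℚ) ^ i * d.choose i) * p i
  have hp : ∀ i (t : ℕ), (p i).eval (t : ℚ) = MvPolynomial.eval (fun l =>
      (((n + (t : ℤ) • (1 : Fin s → ℤ) + ((d : ℤ) - (i : ℤ)) • (1 : Fin s → ℤ)) l : ℤ) : ℚ)) P := by
    intro i t
    simp only [p]
    rw [← Polynomial.coe_evalRingHom, MvPolynomial.aeval_def, MvPolynomial.hom_eval₂,
      MvPolynomial.eval]
    have e1 : (Polynomial.evalRingHom (t : ℚ)).comp (algebraMap ℚ (Polynomial ℚ)) =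
        RingHom.id ℚ := by
      ext; simp
    rw [e1, MvPolynomial.coe_eval₂Hom]
    congr 1
    funext l
    simp
    ring
  have hq : ∀ t : ℕ, q.eval (t : ℚ) = (fwdDiff (1 : Fin s → ℤ))^[d]
      (fun m => MvPolynomial.eval (fun i => (m i : ℚ)) P) (n + (t : ℤ) • (1 : Fin s → ℤ)) := by
    intro t
    rw [fwdDiff_iter_eq_sum_range, Polynomial.eval_finsetSum]
    refine Finset.sum_congr rfl fun i _ => ?_
    rw [Polynomial.eval_mul, Polynomial.eval_C, hp, mul_assoc]
  obtain ⟨T, hT⟩ := eventually_atTop.mp h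
  have hqc : q = Polynomial.C c := by
    refine Polynomial.eq_of_infinite_eval_eq _ _ (Set.Infinite.mono
      (s := (fun t : ℕ => (t : ℚ)) '' Set.Ici T) ?_
      ((Set.Ici_infinite T).image Nat.cast_injective.injOn))
    rintro _ ⟨t, ht, rfl⟩
    rw [Set.mem_ofPred_eq, Polynomial.eval_C, hq, hT t ht]
  have h0 := hq 0
  rw [hqc, Polynomial.eval_C] at h0
  simpa using h0.symm

end Difference

/-! ### The difference formula. -/

theorem theorem3p2 {R : Type u} [CommRing R] [IsLocalRing R] [IsNoetherianRing R]
    [Infinite (IsLocalRing.ResidueField R)] (hCM : IsCohenMacaulayLocal R)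
    (d : ℕ) (hd : 1 ≤ d) (hdim : ringKrullDim R = (d : WithBot ℕ∞))
    (s : ℕ) (hs : 1 ≤ s) (I : Fin s → Ideal R) (hI : ∀ i, IsMaximalPrimary (I i))
    (F : MultiFiltration I) (hF : F.IsAdmissible) (A : F.CompleteReduction d)
    (e : Fin s → ℤ) (he : e = 1) :
    -- the Hilbert polynomial exists
    F.IsHilbertPolynomial F.hilbertPolynomial ∧
    ∀ n : Fin s → ℤ,
      -- the lengths that occur are finite
      F.hilbertFunction n ≠ ⊤ ∧
      quotientLength (F.ideal (n + (d : ℤ) • e)) (A.J * F.ideal (n + ((d : ℤ) - 1) • e)) ≠ ⊤ ∧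
      (∀ i, Module.length R ((kirbyMehran F n A.y A.y_mem).homology i) ≠ ⊤) ∧
      -- the difference formula
      (fwdDiff e)^[d]
          (fun m => MvPolynomial.eval (fun i => (m i : ℚ)) F.hilbertPolynomial -
            ((F.hilbertFunction m).toNat : ℚ)) n =
        ((quotientLength (F.ideal (n + (d : ℤ) • e))
          (A.J * F.ideal (n + ((d : ℤ) - 1) • e))).toNat : ℚ) -
        ∑ i ∈ Finset.Icc 2 d, (-1 : ℚ) ^ i *
          ((Module.length R ((kirbyMehran F n A.y A.y_mem).homology i)).toNat : ℚ) := by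
  subst he
  have hfin : ∀ n, F.hilbertFunction n ≠ ⊤ := fun n => by
    obtain ⟨N, hN⟩ := F.exists_pow_le hI n
    exact length_quotient_ne_top_of_pow_maximalIdeal_le hN
  have hred : ∀ᶠ n in Filter.atTop,
      Ideal.span (Set.range A.y) * F.ideal n = F.ideal (n + 1) := A.reduction
  -- For a large index `m`, `J` contains `J F(m) = F(m+e)`, which contains a power of the maximal
  -- ideal.
  obtain ⟨N, hN⟩ : ∃ N, IsLocalRing.maximalIdeal R ^ N ≤ Ideal.span (Set.range A.y) := by
    obtain ⟨m, hm⟩ := hred.exists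
    obtain ⟨N, hN⟩ := F.exists_pow_le hI (m + 1)
    exact ⟨N, hN.trans (hm.symm.le.trans Ideal.mul_le_left)⟩
  have hJ : Module.length R (R ⧸ Ideal.span (Set.range A.y)) ≠ ⊤ :=
    length_quotient_ne_top_of_pow_maximalIdeal_le hN
  have hJF : ∀ m, Module.length R (R ⧸ Ideal.span (Set.range A.y) * F.ideal m) ≠ ⊤ := fun m => by
    obtain ⟨M, hM⟩ := F.exists_pow_le hI m
    refine length_quotient_ne_top_of_pow_maximalIdeal_le (N := N + M) ?_
    rw [pow_add]
    exact Ideal.mul_mono hN hM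
  -- The regular sequence of length `d` in the maximal ideal lies in the radical of `J`, and `J` has
  -- exactly `d` generators.
  have hex : ∀ i, KoszulExactMod A.y ⊥ i := by
    obtain ⟨rs, hrs, hreg, hlen⟩ := hCM
    rw [hdim] at hlen
    have hlen' : rs.length = d := by exact_mod_cast hlen
    exact koszulExactMod_of_isWeaklyRegular A.y rs hlen'.ge hreg.toIsWeaklyRegular
      fun r hr => ⟨N, hN (Ideal.pow_mem_pow (hrs r hr) N)⟩
  have hP : F.IsHilbertPolynomial F.hilbertPolynomial := by
    have h := hF.exists_isHilbertPolynomial hfin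
    rw [MultiFiltration.hilbertPolynomial, dif_pos h]
    exact h.choose_spec
  refine ⟨hP, fun n => ⟨hfin n, ?_, length_homology_kirbyMehran_ne_top F A.y A.y_mem hfin n, ?_⟩⟩
  · refine ne_top_of_le_ne_top (hJF (n + ((d : ℤ) - 1) • (1 : Fin s → ℤ))) ?_
    refine le_self_add.trans (length_quotient_add_quotientLength ?_).le
    refine (span_range_mul_le F A.y _ A.y_mem).trans (le_of_eq (congrArg F.ideal ?_))
    ext t; simp [add_assoc]
  · set H : (Fin s → ℤ) → ℚ := fun m => ((F.hilbertFunction m).toNat : ℚ)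
    set G : (Fin s → ℤ) → ℚ := fun m => MvPolynomial.eval (fun i => (m i : ℚ)) F.hilbertPolynomial
    have hsub : (fun m => MvPolynomial.eval (fun i => (m i : ℚ)) F.hilbertPolynomial -
        ((F.hilbertFunction m).toNat : ℚ)) = G + (-1 : ℚ) • H := by
      funext m
      simp [G, H, sub_eq_add_neg]
    have hG : (fwdDiff (1 : Fin s → ℤ))^[d] G n =
        ((Module.length R (R ⧸ Ideal.span (Set.range A.y))).toNat : ℚ) := by
      refine fwdDiff_iter_eval_eq_of_eventually _ d n _ ?_
      -- The `d`-th difference at a point involves only `d + 1` values, so `P` and `H` need to agree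
      -- only on these finitely many parallel rays.
      have h1 : ∀ᶠ t : ℕ in Filter.atTop, ∀ i ∈ Finset.range (d + 1),
          G (n + ((d : ℤ) - (i : ℤ)) • (1 : Fin s → ℤ) + (t : ℤ) • (1 : Fin s → ℤ)) =
          H (n + ((d : ℤ) - (i : ℤ)) • (1 : Fin s → ℤ) + (t : ℤ) • (1 : Fin s → ℤ)) := by
        rw [Filter.eventually_all_finset]
        exact fun i _ => (eventually_add_nsmul_one hP _).mono fun t ht => ht.2
      filter_upwards [h1, eventually_fwdDiff_iter_hilbertFunction_eq F A.y hd hred A.y_mem hfin hJ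
        hJF hex n] with t ht1 ht2
      rw [← ht2]
      change (fwdDiff (1 : Fin s → ℤ))^[d] G _ = (fwdDiff (1 : Fin s → ℤ))^[d] H _
      rw [fwdDiff_iter_eq_sum_range, fwdDiff_iter_eq_sum_range]
      refine Finset.sum_congr rfl fun i hi => ?_
      rw [add_right_comm, ht1 i hi]
    rw [hsub, fwdDiff_iter_add, fwdDiff_iter_const_smul, Pi.add_apply, Pi.smul_apply, hG,
      fwdDiff_iter_hilbertFunction F A.y A.y_mem hd hfin hJ hJF (hex 0) n, smul_eq_mul]
    change _ = ((quotientLength (F.ideal (n + (d : ℤ) • (1 : Fin s → ℤ)))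
      (Ideal.span (Set.range A.y) * F.ideal (n + ((d : ℤ) - 1) • (1 : Fin s → ℤ)))).toNat : ℚ) - _
    ring
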